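/- Let $K$ be the two-variable Kauffman polynomial of unoriented link diagrams in the plane, with values in $\mathbb{Z}[a^{\pm1},z^{\pm1}]$. It is the regular isotopy invariant defined by $K(L_+)+K(L_-)=z\,(K(L_a)+K(L_b))$ (where $L_a,L_b$ are the two smoothings of the crossing), by $K(L_{pos})=a^{-1}K(L)$ and $K(L_{neg})=aK(L)$ for diagrams $L_{pos}$, $L_{neg}$ obtained from $L$ by adding a positive, respectively negative, kink, by $K(L\sqcup O)=\left(\frac{a+a^{-1}}{z}-1\right)K(L)$, and by $K(O)=1$ for the crossingless unknot diagram $O$. Let $K(2,q)$ denote its value on the $(2,q)$ torus link diagram, the closure of the two-strand braid $\sigma_1^q$, all of whose crossings are positive. The balanced overlaid Tait graph of this diagram ($q\ge 1$) is the bipartite graph whose vertices are, on one side, the $q$ crossings and, on the other side, the faces of the diagram except for two omitted faces: the inner unshaded face and the shaded face to the right of it, which touch along a strand (faces are checkerboard coloured, the outside face being unshaded). A crossing and a face are adjacent if they touch. Order the crossings from top to bottom. An edge at a shaded face has the letter $L$ if its crossing is the first one at that face and $D$ otherwise; an edge at an unshaded face has the letter $\ell$ if its crossing is the first one at that face and $d$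 otherwise. Let $P_q\in\mathbb{Z}[L,\ell,D,d]$ be the sum over all perfect matchings of the products of the letters of their edges, specialized via $L=a=\ell^{-1}$ and $D=d=z$, and put $P_0=\frac{a+a^{-1}}{z}-1$. Let $g_0=1$, $g_1=z$ and $g_n=z\,g_{n-1}-g_{n-2}$. Theorem. For all $q\ge 2$, $$K(2,q)=P_q-\sum_{i=0}^{q-2}P_i\,g_{q-2-i}.$$ More precisely, this identity follows from the defining relations: in the skein module of link diagrams over $\mathbb{Z}[a^{\pm1},z^{\pm1}]$ modulo the relations for $K$, the class of the $(2,q)$ torus link diagram is the right-hand side times the class of $O$, and every $\mathbb{Z}[a^{\pm1},z^{\pm1}]$-valued function on diagrams that satisfies the relations and takes the value $1$ on $O$ has the right-hand side as its value. For every $q\ge1$ the unspecialized sum over perfect matchings is the determinant of the $q\times q$ crossing-by-face matrix of edge letters (with $0$ for non-adjacent pairs), after a suitable choice of signs of the entries and of an ordering of the faces. Moreover, there is an algorithm which computes all coefficients of $K(2,q)$ from the number $q\geq 2$ of crossings in a number of steps that is polynomial in $q$ (on a random access machine with integer memory cells whose only arithmetic operations are addition and subtraction). -/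

import Mathlib

namespace KauffmanTorus

/-! ### Link diagrams -/

/-- Elementary pieces of a link diagram cut by horizontal lines and read from top to bottom.
`birth` is a local maximum, `death` is a local minimum, and `cross true` (resp. `cross false`) is a
crossing of two neighbouring strands which is positive (resp. negative) when both strands are
oriented downwards (in `cross true` the strand running from top right to bottom left is over). -/
inductive Kind where
  | birth : Kind
  | death : Kind
  | cross : Bool → Kind
  deriving DecidableEq

/-- Number of strands entering an elementary piece from above. -/
def Kind.top : Kind → ℕ
  | .birth => 0
  | .death => 2
  | .cross _ => 2

/-- Number of strands leaving an elementary piece below. -/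
def Kind.bot : Kind → ℕ
  | .birth => 2
  | .death => 0
  | .cross _ => 2

/-- A horizontal slice of a diagram: an elementary piece that has exactly `pos` strands on its
left; all other strands run straight down. -/
structure Slice where
  kind : Kind
  pos : ℕ
  deriving DecidableEq

abbrev birth (i : ℕ) : Slice := ⟨.birth, i⟩
abbrev death (i : ℕ) : Slice := ⟨.death, i⟩
abbrev cross (ε : Bool) (i : ℕ) : Slice := ⟨.cross ε, i⟩

/-- The number of strands below a list of slices which has `n` strands above it. -/
def width : ℕ → List Slice → ℕ
  | n, [] => n
  | n, s :: w => width (n - s.kind.top + s.kind.bot) w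

/-- The slices fit together, starting with `n` strands above and ending with no strand. -/
def Closes : ℕ → List Slice → Prop
  | n, [] => n = 0
  | n, s :: w => s.pos + s.kind.top ≤ n ∧ Closes (n - s.kind.top + s.kind.bot) w

/-- A (non-empty, unoriented) link diagram in the plane, presented by its slices. -/
structure LinkDiagram where
  word : List Slice
  ne_nil : word ≠ []
  closes : Closes 0 word

/-- The crossingless diagram `O` of the unknot. -/
def unknot : LinkDiagram where
  word := [birth 0, death 0]
  ne_nil := by simp
  closes := by simp [Closes, Kind.top, Kind.bot]

theorem closes_replicate (q : ℕ) (w : List Slice) (h : Closes 4 w) :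
    Closes 4 (List.replicate q (cross true 0) ++ w) := by
  induction q with
  | zero => simpa using h
  | succ q ih => simpa [List.replicate_succ, Closes, Kind.top, Kind.bot] using ih

/-- The `(2,q)` torus link: the closure on the right of the braid `σ₁ ^ q` on two strands. -/
def torusLink (q : ℕ) : LinkDiagram where
  word := [birth 0, birth 1] ++ (List.replicate q (cross true 0) ++ [death 1, death 0])
  ne_nil := by simp
  closes := by
    have h := closes_replicate q [death 1, death 0] (by simp [Closes, Kind.top, Kind.bot])
    simpa [Closes, Kind.top, Kind.bot] using h

/-! ### The Kauffman polynomial -/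

/-- Laurent polynomials in two variables `a`, `z` with integer coefficients. -/
abbrev Laurent : Type := AddMonoidAlgebra ℤ (ℤ × ℤ)

/-- The monomial `a ^ i * z ^ j`. -/
noncomputable def mono (i j : ℤ) : Laurent := AddMonoidAlgebra.single (i, j) 1

/-- The factor `(a + a⁻¹) / z - 1` of a split unknotted circle. -/
noncomputable def delta : Laurent := (mono 1 0 + mono (-1) 0) * mono 0 (-1) - 1

/-- Local moves generating regular isotopy of diagrams cut into slices: planar isotopies, and the
second and third Reidemeister moves (not the first). -/
inductive Move : List Slice → List Slice → Prop
  /-- Pieces side by side exchange their heights. -/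
  | exchange (k l : Kind) (i d : ℕ) :
      Move [⟨k, i⟩, ⟨l, i + k.bot + d⟩] [⟨l, i + k.top + d⟩, ⟨k, i⟩]
  /-- A maximum and a minimum next to each other on a strand cancel. -/
  | zigzag_left (i : ℕ) : Move [birth i, death (i + 1)] []
  | zigzag_right (i : ℕ) : Move [birth (i + 1), death i] []
  /-- A maximum, or a minimum, moves along its strand past a crossing, which is turned. -/
  | turn_birth (ε : Bool) (i : ℕ) :
      Move [birth i, cross ε (i + 1)] [birth (i + 1), cross (!ε) i]
  | turn_death (ε : Bool) (i : ℕ) :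
      Move [cross ε (i + 1), death i] [cross (!ε) i, death (i + 1)]
  | reidemeister_two (ε : Bool) (i : ℕ) : Move [cross ε i, cross (!ε) i] []
  | reidemeister_three (ε : Bool) (i : ℕ) :
      Move [cross ε i, cross ε (i + 1), cross ε i]
        [cross ε (i + 1), cross ε i, cross ε (i + 1)]

/-- `Kink ε x y`: the piece `x` is the piece `y` with one kink added to a strand; the kink is
positive if `ε = true` and negative if `ε = false`. In the first two pictures both passages through
the crossing run downwards, so the sign of the kink is that of the slice; in the last two one
passage runs upwards, so the sign is opposite. -/
inductive Kink : Bool → List Slice → List Slice → Prop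
  | right (ε : Bool) (i : ℕ) : Kink ε [birth (i + 1), cross ε i, death (i + 1)] []
  | left (ε : Bool) (i : ℕ) : Kink ε [birth i, cross ε (i + 1), death i] []
  | up (ε : Bool) (i : ℕ) : Kink ε [birth i, cross (!ε) i] [birth i]
  | down (ε : Bool) (i : ℕ) : Kink ε [cross (!ε) i, death i] [death i]

/-- Formal linear combinations of diagrams. -/
abbrev Chains : Type := LinkDiagram →₀ Laurent

/-- A diagram as a formal linear combination. -/
noncomputable abbrev chain (D : LinkDiagram) : Chains := Finsupp.single D 1

/-- `At u x v D`: the diagram `D` is `x` with `u` above and `v` below it. -/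
def At (u x v : List Slice) (D : LinkDiagram) : Prop := D.word = u ++ x ++ v

/-- The defining relations of `K`, as combinations of diagrams that have to vanish:
regular isotopy invariance, the skein relation `L₊ + L₋ = z (L_a + L_b)`, the factor `a⁻¹` for a
positive and `a` for a negative kink, and the factor `(a + a⁻¹) / z - 1` for a split circle. -/
inductive Relator : Chains → Prop
  | isotopy {u v x y : List Slice} {D D' : LinkDiagram} (hm : Move x y)
      (h : At u x v D) (h' : At u y v D') : Relator (chain D - chain D')
  | skein {u v : List Slice} (i : ℕ) {Dp Dm Da Db : LinkDiagram}
      (hp : At u [cross true i] v Dp) (hm : At u [cross false i] v Dm)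
      (ha : At u [] v Da) (hb : At u [death i, birth i] v Db) :
      Relator (chain Dp + chain Dm - mono 0 1 • (chain Da + chain Db))
  | pos_kink {u v x y : List Slice} {D D' : LinkDiagram} (hk : Kink true x y)
      (h : At u x v D) (h' : At u y v D') : Relator (chain D - mono (-1) 0 • chain D')
  | neg_kink {u v x y : List Slice} {D D' : LinkDiagram} (hk : Kink false x y)
      (h : At u x v D) (h' : At u y v D') : Relator (chain D - mono 1 0 • chain D')
  | circle {u v : List Slice} (i : ℕ) {D D' : LinkDiagram}
      (h : At u [birth i, death i] v D) (h' : At u [] v D') :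
      Relator (chain D - delta • chain D')

/-- The Kauffman skein module of the plane: combinations of link diagrams modulo the defining
relations of `K`. -/
abbrev Skein : Type := Chains ⧸ Submodule.span Laurent {x : Chains | Relator x}

/-- The value `K(D)` of the universal solution of the defining relations. The normalisation
`K(O) = 1` identifies a Laurent polynomial `r` with `r • K unknot`. -/
noncomputable def K (D : LinkDiagram) : Skein :=
  (Submodule.span Laurent {x : Chains | Relator x}).mkQ (chain D)

/-- `F` is a Laurent polynomial valued function on diagrams that satisfies the defining relations
and the normalisation `F(O) = 1`. -/
def IsKauffmanPolynomial (F : LinkDiagram → Laurent) : Prop :=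
  F unknot = 1 ∧ ∀ x, Relator x → Finsupp.linearCombination Laurent F x = 0

/-! ### The balanced overlaid Tait graph -/

/-- The number of strands at height `t`, that is, below the first `t` slices. -/
def strandsAt (w : List Slice) (t : ℕ) : ℕ := width 0 (w.take t)

/-- An interval between neighbouring strands on the horizontal line at some height; interval
number `g` has `g` strands on its left. -/
abbrev Gap (w : List Slice) : Type :=
  Σ t : Fin (w.length + 1), Fin (strandsAt w t + 1)

/-- The intervals `c`, `c'` above and below one slice lie in the same region of that slice. -/
def SameRegion (w : List Slice) (c c' : Gap w) : Prop :=
  ∃ s : Slice, w[(c.1 : ℕ)]? = some s ∧ (c'.1 : ℕ) = c.1 + 1 ∧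
    (((c.2 : ℕ) ≤ s.pos ∧ (c'.2 : ℕ) = c.2) ∨
      ∃ d : ℕ, (c.2 : ℕ) = s.pos + s.kind.top + d ∧ (c'.2 : ℕ) = s.pos + s.kind.bot + d)

/-- The faces of a diagram: intervals glued along the regions of all slices. -/
abbrev Face (w : List Slice) : Type := Quot (SameRegion w)

theorem SameRegion.odd_iff {w : List Slice} {c c' : Gap w} (h : SameRegion w c c') :
    Odd (c.2 : ℕ) ↔ Odd (c'.2 : ℕ) := by
  obtain ⟨⟨k, i⟩, -, -, ⟨-, h⟩ | ⟨d, h, h'⟩⟩ := h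
  · rw [h]
  · rw [h, h']
    cases k <;> simp [Kind.top, Kind.bot, parity_simps]

/-- The checkerboard colouring in which the outside face is not shaded. -/
def Shaded {w : List Slice} : Face w → Prop :=
  Quot.lift (fun c => Odd (c.2 : ℕ)) fun _ _ h => propext h.odd_iff

/-- The crossings of a diagram, ordered from top to bottom. -/
abbrev Crossing (w : List Slice) : Type :=
  {t : Fin w.length // ∃ ε, (w.get t).kind = .cross ε}

/-- The face `f` is one of the four corners at the crossing `v`. -/
def Touches {w : List Slice} (v : Crossing w) (f : Face w) : Prop :=
  ∃ c : Gap w, Quot.mk _ c = f ∧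
    (((c.1 : ℕ) = v.1 ∧ ((c.2 : ℕ) = (w.get v.1).pos ∨ (c.2 : ℕ) = (w.get v.1).pos + 1 ∨
        (c.2 : ℕ) = (w.get v.1).pos + 2)) ∨
      ((c.1 : ℕ) = v.1 + 1 ∧ (c.2 : ℕ) = (w.get v.1).pos + 1))

/-- The face `f` is one of the two faces that touch along the strand which has `g` strands on its
left at height `t`. -/
def Beside {w : List Slice} (t g : ℕ) (f : Face w) : Prop :=
  ∃ c : Gap w, Quot.mk _ c = f ∧ (c.1 : ℕ) = t ∧ ((c.2 : ℕ) = g ∨ (c.2 : ℕ) = g + 1)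

/-- The second vertex class of the balanced overlaid Tait graph (the first one is `Crossing w`):
all faces but the two that touch along the chosen strand. A crossing and a face are adjacent if they
touch. -/
abbrev TaitFace (w : List Slice) (t g : ℕ) : Type := {f : Face w // ¬ Beside t g f}

noncomputable instance (w : List Slice) (t g : ℕ) : Fintype (TaitFace w t g) :=
  Fintype.ofFinite _

/-- Activity letters of positive crossings. -/
inductive Letter where
  | L : Letter
  | ell : Letter
  | D : Letter
  | d : Letter
  deriving DecidableEq

open Classical in
/-- The activity letter of the edge between `v` and `f` of the balanced overlaid Tait graph of a
diagram all of whose crossings are positive (so that no barred letters occur). -/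
noncomputable def letter {w : List Slice} (v : Crossing w) (f : Face w) : Letter :=
  if ∀ v' : Crossing w, Touches v' f → v ≤ v' then
    if Shaded f then .L else .ell
  else
    if Shaded f then .D else .d

/-- A set of edges of the balanced overlaid Tait graph that covers every vertex exactly once. -/
def IsPerfectMatching {w : List Slice} {t g : ℕ} (M : Finset (Crossing w × TaitFace w t g)) :
    Prop :=
  (∀ e ∈ M, Touches e.1 e.2.1) ∧ (∀ v, ∃! f, (v, f) ∈ M) ∧ (∀ f, ∃! v, (v, f) ∈ M)

open Classical in
/-- The sum of the activity words of all perfect matchings. -/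
noncomputable def matchingPolynomial (w : List Slice) (t g : ℕ) : MvPolynomial Letter ℤ :=
  ∑ M : Finset (Crossing w × TaitFace w t g) with IsPerfectMatching M,
    ∏ e ∈ M, MvPolynomial.X (letter e.1 e.2.1)

open Classical in
/-- The modified adjacency matrix: activity letters at the edges, zero elsewhere. -/
noncomputable def adjacencyMatrix (w : List Slice) (t g : ℕ) :
    Matrix (Crossing w) (TaitFace w t g) (MvPolynomial Letter ℤ) :=
  fun v f => if Touches v f.1 then MvPolynomial.X (letter v f.1) else 0

/-- The specialisation `L = a`, `ℓ = a⁻¹`, `D = d = z`. -/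
noncomputable def specialize : Letter → Laurent
  | .L => mono 1 0
  | .ell => mono (-1) 0
  | .D => mono 0 1
  | .d => mono 0 1

/-- `P_0 = (a + a⁻¹) / z - 1`, and for `q ≥ 1` the specialised sum of activity words of the perfect
matchings of the balanced overlaid Tait graph of the `(2,q)` torus link. The two omitted faces are
the two rightmost bounded ones: those touching along the third of the four strands below the two
maxima. -/
noncomputable def P : ℕ → Laurent
  | 0 => delta
  | q + 1 => MvPolynomial.aeval specialize (matchingPolynomial (torusLink (q + 1)).word 2 2)

/-- `g_0 = 1`, `g_1 = z`, `g_n = z g_{n-1} - g_{n-2}`. -/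
noncomputable def g : ℕ → Laurent
  | 0 => 1
  | 1 => mono 0 1
  | n + 2 => mono 0 1 * g (n + 1) - g n

/-! ### Computation in polynomial time -/

/-- Programs of a random access machine whose memory cells hold integers. Additions and
subtractions are the only arithmetic operations, so that after `t` steps all numbers have
`O(t)` bits more than the input, and a count of steps that is polynomial means polynomial time in
the usual sense. -/
inductive Program where
  /-- `mem[x] := c` -/
  | const (x c : ℤ) : Program
  /-- `mem[x] := mem[y] + mem[y']` -/
  | add (x y y' : ℤ) : Program
  /-- `mem[x] := mem[y] - mem[y']` -/
  | sub (x y y' : ℤ) : Program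
  /-- `mem[x] := mem[mem[y]]` -/
  | load (x y : ℤ) : Program
  /-- `mem[mem[x]] := mem[y]` -/
  | store (x y : ℤ) : Program
  | seq (p p' : Program) : Program
  /-- if `mem[x] > 0` then `p` else `p'` -/
  | ifPos (x : ℤ) (p p' : Program) : Program
  /-- while `mem[x] > 0` do `p` -/
  | whilePos (x : ℤ) (p : Program) : Program

/-- `Runs p m m' t`: the program `p`, started with memory `m`, halts after `t` steps with memory
`m'`. Every assignment and every test is one step. -/
inductive Runs : Program → (ℤ → ℤ) → (ℤ → ℤ) → ℕ → Prop
  | const (x c : ℤ) (m : ℤ → ℤ) : Runs (.const x c) m (Function.update m x c) 1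
  | add (x y y' : ℤ) (m : ℤ → ℤ) : Runs (.add x y y') m (Function.update m x (m y + m y')) 1
  | sub (x y y' : ℤ) (m : ℤ → ℤ) : Runs (.sub x y y') m (Function.update m x (m y - m y')) 1
  | load (x y : ℤ) (m : ℤ → ℤ) : Runs (.load x y) m (Function.update m x (m (m y))) 1
  | store (x y : ℤ) (m : ℤ → ℤ) : Runs (.store x y) m (Function.update m (m x) (m y)) 1
  | seq {p p' : Program} {m m' m'' : ℤ → ℤ} {t t' : ℕ} (h : Runs p m m' t)
      (h' : Runs p' m' m'' t') : Runs (.seq p p') m m'' (t + t')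
  | ifPos_true {x : ℤ} {p p' : Program} {m m' : ℤ → ℤ} {t : ℕ} (hx : 0 < m x)
      (h : Runs p m m' t) : Runs (.ifPos x p p') m m' (t + 1)
  | ifPos_false {x : ℤ} {p p' : Program} {m m' : ℤ → ℤ} {t : ℕ} (hx : m x ≤ 0)
      (h : Runs p' m m' t) : Runs (.ifPos x p p') m m' (t + 1)
  | while_true {x : ℤ} {p : Program} {m m' m'' : ℤ → ℤ} {t t' : ℕ} (hx : 0 < m x)
      (h : Runs p m m' t) (h' : Runs (.whilePos x p) m' m'' t') :
      Runs (.whilePos x p) m m'' (t + t' + 1)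
  | while_false {x : ℤ} {p : Program} {m : ℤ → ℤ} (hx : m x ≤ 0) : Runs (.whilePos x p) m m 1

/-- The initial memory: the number `q` of crossings in cell `0`, zero elsewhere. -/
def input (q : ℕ) : ℤ → ℤ := Function.update 0 0 (q : ℤ)

/-- The Laurent polynomial `∑ c_{ij} a ^ (i - 1) z ^ (j - 1)`, `0 ≤ i, j ≤ q`, whose coefficients
are stored row by row in the cells `0, …, (q + 1) ^ 2 - 1`. -/
noncomputable def output (q : ℕ) (m : ℤ → ℤ) : Laurent :=
  ∑ i ∈ Finset.range (q + 1), ∑ j ∈ Finset.range (q + 1),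
    m ((i : ℤ) * (q + 1) + j) • mono ((i : ℤ) - 1) ((j : ℤ) - 1)

end KauffmanTorus

open KauffmanTorus

namespace KauffmanTorus

/-! ### The skein recursion -/

/-! Write `T q` for the coefficient of `K unknot` in `K (torusLink q)`. Apply the skein relation to
the last crossing: reversing it cancels the crossing before it by the second Reidemeister move, the
vertical smoothing removes it, and the horizontal smoothing turns all other crossings into negative
kinks. Hence `T (q+2) = z T (q+1) - T q + a^(q+1) z`, with `T 0 = delta` and `T 1 = a⁻¹`
(`K_torusLink`). A Laurent polynomial valued solution of the relations factors through the skein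
module, so it takes the same values.

Among the faces that are kept, the outside face touches every crossing and each bigon touches two
consecutive ones. Once the outside face is matched with crossing `k`, every earlier crossing must
take the bigon below it and every later one the bigon above it. The `q` matchings are therefore the
cycles `Fin.cycleRange k` (`perm_eq_cycleRange`), and summing their weights gives `P (q+2) = z P
(q+1) + a^(q+1) z` (`P_add_two`). This is the recursion of `T` without the term `-T q`. Convolution
with `g`, the solution of the homogeneous recursion, supplies that term
(`torusPolynomial_eq_of_recursion`). The determinant has the same nonzero terms up to sign, and the
signs can be absorbed into the column of the outside face.

The algorithm tabulates the recursion of `T`. Each polynomial is a flat block of coefficients, so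
multiplication by `z` is a shift of addresses and a cell needs only one addition and one subtraction
of cells already computed (`cellValue_recursion`). There are cubically many cells, each at constant
cost. -/

theorem mono_mul_mono (i j k l : ℤ) : mono i j * mono k l = mono (i + k) (j + l) := by
  simp [mono, AddMonoidAlgebra.single_mul_single]

theorem mono_zero : mono 0 0 = 1 := rfl

theorem mkQ_eq_zero {x : Chains} (h : Relator x) :
    (Submodule.span Laurent {x : Chains | Relator x}).mkQ x = 0 := by
  rw [Submodule.mkQ_apply, Submodule.Quotient.mk_eq_zero]
  exact Submodule.subset_span h

theorem K_isotopy {u v x y : List Slice} {D D' : LinkDiagram} (hm : Move x y)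
    (h : At u x v D) (h' : At u y v D') : K D = K D' := by
  have := mkQ_eq_zero (Relator.isotopy hm h h')
  rwa [map_sub, sub_eq_zero] at this

theorem K_skein {u v : List Slice} (i : ℕ) {Dp Dm Da Db : LinkDiagram}
    (hp : At u [cross true i] v Dp) (hm : At u [cross false i] v Dm)
    (ha : At u [] v Da) (hb : At u [death i, birth i] v Db) :
    K Dp = mono 0 1 • (K Da + K Db) - K Dm := by
  have := mkQ_eq_zero (Relator.skein i hp hm ha hb)
  rw [map_sub, map_add, map_smul, map_add, sub_eq_zero] at this
  exact eq_sub_of_add_eq this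

theorem K_pos_kink {u v x y : List Slice} {D D' : LinkDiagram} (hk : Kink true x y)
    (h : At u x v D) (h' : At u y v D') : K D = mono (-1) 0 • K D' := by
  have := mkQ_eq_zero (Relator.pos_kink hk h h')
  rwa [map_sub, map_smul, sub_eq_zero] at this

theorem K_neg_kink {u v x y : List Slice} {D D' : LinkDiagram} (hk : Kink false x y)
    (h : At u x v D) (h' : At u y v D') : K D = mono 1 0 • K D' := by
  have := mkQ_eq_zero (Relator.neg_kink hk h h')
  rwa [map_sub, map_smul, sub_eq_zero] at this

theorem K_circle {u v : List Slice} (i : ℕ) {D D' : LinkDiagram}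
    (h : At u [birth i, death i] v D) (h' : At u [] v D') : K D = delta • K D' := by
  have := mkQ_eq_zero (Relator.circle i h h')
  rwa [map_sub, map_smul, sub_eq_zero] at this

/-- A relation `K D = r • K unknot` determines the values of all Kauffman polynomials at `D`. -/
theorem IsKauffmanPolynomial.eq_of_K_eq_smul {F : LinkDiagram → Laurent}
    (hF : IsKauffmanPolynomial F) {D : LinkDiagram} {r : Laurent} (h : K D = r • K unknot) :
    F D = r := by
  let φ : Skein →ₗ[Laurent] Laurent :=
    (Submodule.span Laurent {x : Chains | Relator x}).liftQ (Finsupp.linearCombination Laurent F)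
      (Submodule.span_le.2 fun x hx => hF.2 x hx)
  have hφ (D : LinkDiagram) : φ (K D) = F D := by
    simp [φ, K, Submodule.liftQ_apply, chain]
  rw [← hφ, h, map_smul, hφ, hF.1, smul_eq_mul, mul_one]

/-- The closed diagram consisting of two nested maxima, `q` crossings and a bottom part `w`. -/
def capped (q : ℕ) (w : List Slice) (h : Closes 4 w) : LinkDiagram where
  word := [birth 0, birth 1] ++ (List.replicate q (cross true 0) ++ w)
  ne_nil := by simp
  closes := by simpa [Closes, Kind.top, Kind.bot] using closes_replicate q w h

/-- The torus link with a horizontal smoothing below its crossings. -/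
def cupped (q : ℕ) : LinkDiagram :=
  capped q [death 0, birth 0, death 1, death 0] (by simp [Closes, Kind.top, Kind.bot])

/-- The torus link with an additional negative crossing. -/
def clasped (q : ℕ) : LinkDiagram :=
  capped q [cross false 0, death 1, death 0] (by simp [Closes, Kind.top, Kind.bot])

theorem K_clasped (q : ℕ) : K (clasped (q + 1)) = K (torusLink q) :=
  K_isotopy (Move.reidemeister_two true 0)
    (u := [birth 0, birth 1] ++ List.replicate q (cross true 0)) (v := [death 1, death 0])
    (by simp [At, clasped, capped, List.replicate_succ']) (by simp [At, torusLink])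

/-- The last crossing becomes a kink on the minimum below it. One passage through it now runs
upwards, so a crossing that is positive in the braid is a negative kink and contributes `a`. -/
theorem K_cupped_succ (q : ℕ) : K (cupped (q + 1)) = mono 1 0 • K (cupped q) :=
  K_neg_kink (Kink.down false 0)
    (u := [birth 0, birth 1] ++ List.replicate q (cross true 0)) (v := [birth 0, death 1, death 0])
    (by simp [At, cupped, capped, List.replicate_succ']) (by simp [At, cupped, capped])

theorem K_cupped_zero : K (cupped 0) = K unknot := by
  let D : LinkDiagram := ⟨[birth 0, birth 0, death 1, death 0], by simp,
    by simp [Closes, Kind.top, Kind.bot]⟩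
  have h₁ : K (cupped 0) = K D :=
    K_isotopy (Move.zigzag_right 0) (u := [birth 0]) (v := [birth 0, death 1, death 0])
      (by simp [At, cupped, capped]) (by simp [At, D])
  have h₂ : K D = K unknot :=
    K_isotopy (Move.zigzag_left 0) (u := [birth 0]) (v := [death 0])
      (by simp [At, D]) (by simp [At, unknot])
  rw [h₁, h₂]

theorem K_cupped (q : ℕ) : K (cupped q) = mono q 0 • K unknot := by
  induction q with
  | zero => rw [K_cupped_zero, Nat.cast_zero, mono_zero, one_smul]
  | succ q ih =>
    rw [K_cupped_succ, ih, smul_smul, mono_mul_mono, Nat.cast_succ, add_comm, add_zero]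

theorem K_torusLink_zero : K (torusLink 0) = delta • K unknot :=
  K_circle 1 (u := [birth 0]) (v := [death 0]) (by simp [At, torusLink]) (by simp [At, unknot])

theorem K_torusLink_one : K (torusLink 1) = mono (-1) 0 • K unknot :=
  K_pos_kink (Kink.right true 0) (u := [birth 0]) (v := [death 0])
    (by simp [At, torusLink]) (by simp [At, unknot])

/-- This is the skein relation at the lowest crossing; `clasped`, `torusLink` and `cupped` at `q +
1` are the reversed crossing and its two smoothings. -/
theorem K_torusLink_add_two (q : ℕ) :
    K (torusLink (q + 2)) =
      mono 0 1 • (K (torusLink (q + 1)) + mono (q + 1) 0 • K unknot) - K (torusLink q) := by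
  have h := K_skein 0 (u := [birth 0, birth 1] ++ List.replicate (q + 1) (cross true 0))
    (v := [death 1, death 0]) (Dp := torusLink (q + 2)) (Dm := clasped (q + 1))
    (Da := torusLink (q + 1)) (Db := cupped (q + 1))
    (by simp [At, torusLink, List.replicate_succ'])
    (by simp [At, clasped, capped]) (by simp [At, torusLink]) (by simp [At, cupped, capped])
  rw [h, K_clasped, K_cupped, Nat.cast_succ]

/-- The coefficient of `K unknot` in `K (torusLink q)`. -/
noncomputable def torusPolynomial : ℕ → Laurent
  | 0 => delta
  | 1 => mono (-1) 0
  | q + 2 => mono 0 1 * torusPolynomial (q + 1) - torusPolynomial q + mono (q + 1) 1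

theorem K_torusLink (q : ℕ) : K (torusLink q) = torusPolynomial q • K unknot := by
  induction q using torusPolynomial.induct with
  | case1 => exact K_torusLink_zero
  | case2 => exact K_torusLink_one
  | case3 q ih₁ ih₀ =>
    rw [K_torusLink_add_two, ih₁, ih₀, torusPolynomial, add_smul, sub_smul, smul_add, smul_smul,
      smul_smul, mono_mul_mono, zero_add, add_zero]
    abel

/-- The recursion solved in terms of an inhomogeneity `p` and the Chebyshev polynomials `g`. -/
theorem torusPolynomial_eq_of_recursion {p : ℕ → Laurent} (h0 : p 0 = delta)
    (h1 : p 1 = mono (-1) 0)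
    (h2 : ∀ q : ℕ, p (q + 2) = mono 0 1 * p (q + 1) + mono (q + 1) 1) {q : ℕ} (hq : 2 ≤ q) :
    torusPolynomial q = p q - ∑ i ∈ Finset.range (q - 1), p i * g (q - 2 - i) := by
  -- Convolution with `g` inherits the recursion of `g`: it applies termwise for `i < n`, while `i =
  -- n` and `i = n + 1` involve only `g 1` and `g 0` and leave `p (n + 1)` as the inhomogeneity.
  have key (n : ℕ) : ∑ i ∈ Finset.range (n + 2), p i * g (n + 1 - i) =
      mono 0 1 * ∑ i ∈ Finset.range (n + 1), p i * g (n - i) -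
        ∑ i ∈ Finset.range n, p i * g (n - 1 - i) + p (n + 1) := by
    have h (i : ℕ) (hi : i ∈ Finset.range n) : p i * g (n + 1 - i) =
        mono 0 1 * (p i * g (n - i)) - p i * g (n - 1 - i) := by
      obtain ⟨k, rfl⟩ := Nat.exists_eq_add_of_lt (Finset.mem_range.1 hi)
      rw [show i + k + 1 + 1 - i = k + 2 by omega, show i + k + 1 - i = k + 1 by omega,
        show i + k + 1 - 1 - i = k by omega, g]
      ring
    rw [Finset.sum_range_succ, Finset.sum_range_succ, Finset.sum_congr rfl h,
      Finset.sum_range_succ, Finset.sum_sub_distrib, ← Finset.mul_sum]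
    simp only [Nat.sub_self, Nat.add_sub_cancel_left, g]
    ring
  obtain ⟨n, rfl⟩ := Nat.exists_eq_add_of_le' hq
  simp only [Nat.add_sub_cancel, show n + 2 - 1 = n + 1 from rfl]
  clear hq
  induction n using Nat.twoStepInduction with
  | zero =>
    simp [torusPolynomial, h2, h1, h0, g]
    ring
  | one =>
    simp [torusPolynomial, h2, h1, h0, g, Finset.sum_range_succ]
    ring
  | more n ih₀ ih₁ =>
    rw [torusPolynomial, ih₁, ih₀, h2 (n + 2), key (n + 1), Nat.add_sub_cancel]
    push_cast
    ring

/-! ### The faces of the torus link diagram -/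

theorem torusLink_word_getElem? (q t : ℕ) : (torusLink q).word[t]? =
    if t = 0 then some (birth 0) else if t = 1 then some (birth 1)
    else if t < q + 2 then some (cross true 0) else if t = q + 2 then some (death 1)
    else if t = q + 3 then some (death 0) else none := by
  match t with
  | 0 => rfl
  | 1 => rfl
  | t + 2 =>
    simp only [torusLink, List.cons_append, List.nil_append, List.getElem?_cons_succ]
    rw [List.getElem?_append, List.length_replicate]
    by_cases h : t < q
    · simp [h]
    · obtain ⟨k, rfl⟩ := Nat.exists_eq_add_of_le (not_lt.1 h)
      match k with
      | 0 => simp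
      | 1 => simp
      | k + 2 => simp

theorem torusLink_slice_cases {q t : ℕ} {s : Slice} (h : (torusLink q).word[t]? = some s) :
    (t = 0 ∧ s = birth 0) ∨ (t = 1 ∧ s = birth 1) ∨ (2 ≤ t ∧ t < q + 2 ∧ s = cross true 0) ∨
      (t = q + 2 ∧ s = death 1) ∨ (t = q + 3 ∧ s = death 0) := by
  rw [torusLink_word_getElem?] at h
  split_ifs at h with h0 h1 h2 h3 h4
  · exact .inl ⟨h0, (Option.some.inj h).symm⟩
  · exact .inr (.inl ⟨h1, (Option.some.inj h).symm⟩)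
  · exact .inr (.inr (.inl ⟨by omega, h2, (Option.some.inj h).symm⟩))
  · exact .inr (.inr (.inr (.inl ⟨h3, (Option.some.inj h).symm⟩)))
  · exact .inr (.inr (.inr (.inr ⟨h4, (Option.some.inj h).symm⟩)))

theorem torusLink_word_length (q : ℕ) : (torusLink q).word.length = q + 4 := by
  simp [torusLink]

theorem width_append (n : ℕ) (u v : List Slice) : width n (u ++ v) = width (width n u) v := by
  induction u generalizing n with
  | nil => rfl
  | cons s u ih => exact ih _

theorem strandsAt_succ {w : List Slice} {t : ℕ} {s : Slice} (h : w[t]? = some s) :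
    strandsAt w (t + 1) = strandsAt w t - s.kind.top + s.kind.bot := by
  rw [strandsAt, List.take_add_one, width_append, h]
  rfl

theorem strandsAt_torusLink {q t : ℕ} (ht : t ≤ q + 4) :
    (t = 0 ∧ strandsAt (torusLink q).word t = 0) ∨
    (t = 1 ∧ strandsAt (torusLink q).word t = 2) ∨
    (2 ≤ t ∧ t ≤ q + 2 ∧ strandsAt (torusLink q).word t = 4) ∨
    (t = q + 3 ∧ strandsAt (torusLink q).word t = 2) ∨
    (t = q + 4 ∧ strandsAt (torusLink q).word t = 0) := by
  induction t with
  | zero => exact .inl ⟨rfl, rfl⟩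
  | succ t ih =>
    have hlt : t < (torusLink q).word.length := by rw [torusLink_word_length]; omega
    have hs := List.getElem?_eq_getElem hlt
    specialize ih (by omega)
    rw [strandsAt_succ hs]
    rcases torusLink_slice_cases hs with ⟨h, h'⟩ | ⟨h, h'⟩ | ⟨h2, h, h'⟩ | ⟨h, h'⟩ | ⟨h, h'⟩ <;>
      rw [h'] <;> simp only [Kind.top, Kind.bot] <;> omega

/-- A number characterising the face of the torus link diagram that contains an interval: `0` for
the outside face, `b` for the bigon between the crossings number `b - 1` and `b`, `q` for the shaded
face outside the bigons and `q + 1` for the inner unshaded face. -/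
def gapLabel (q t g : ℕ) : ℕ :=
  if g = 0 ∨ g = 4 ∨ (g = 2 ∧ (t ≤ 1 ∨ q + 3 ≤ t)) then 0
  else if g = 2 then q + 1
  else if g = 1 ∧ 3 ≤ t ∧ t ≤ q + 1 then t - 2 else q

theorem gapLabel_cases (q t g : ℕ) :
    ((g = 0 ∨ g = 4 ∨ (g = 2 ∧ (t ≤ 1 ∨ q + 3 ≤ t))) ∧ gapLabel q t g = 0) ∨
    (g = 2 ∧ 2 ≤ t ∧ t ≤ q + 2 ∧ gapLabel q t g = q + 1) ∨
    (g = 1 ∧ 3 ≤ t ∧ t ≤ q + 1 ∧ gapLabel q t g = t - 2) ∨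
    (g ≠ 0 ∧ g ≠ 4 ∧ g ≠ 2 ∧ (g = 1 → t ≤ 2 ∨ q + 2 ≤ t) ∧ gapLabel q t g = q) := by
  unfold gapLabel
  split_ifs <;> omega

/-- Intervals enter as bare numbers with their bounds, so that invariance of the label is a linear
arithmetic check for each of the five kinds of height. -/
theorem gapLabel_eq_of_slice {q t t' i i' n : ℕ} {s : Slice}
    (hs : (torusLink q).word[t]? = some s) (ht' : t' = t + 1)
    (hn : strandsAt (torusLink q).word t = n) (hi : i ≤ n) (hi' : i' ≤ n - s.kind.top + s.kind.bot)
    (h : (i ≤ s.pos ∧ i' = i) ∨ ∃ d, i = s.pos + s.kind.top + d ∧ i' = s.pos + s.kind.bot + d) :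
    gapLabel q t i = gapLabel q t' i' := by
  subst ht'
  have h₄ := gapLabel_cases q t i
  have h₄' := gapLabel_cases q (t + 1) i'
  rcases torusLink_slice_cases hs with ⟨ht, rfl⟩ | ⟨ht, rfl⟩ | ⟨h2, ht, rfl⟩ | ⟨ht, rfl⟩ |
    ⟨ht, rfl⟩ <;>
    have h₃ := strandsAt_torusLink (q := q) (t := t) (by omega) <;>
    rw [hn] at h₃ <;>
    simp only [Kind.top, Kind.bot] at h hi' <;>
    rcases h with h | ⟨d, h⟩ <;> omega

theorem SameRegion.gapLabel_eq {q : ℕ} {c c' : Gap (torusLink q).word}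
    (h : SameRegion (torusLink q).word c c') : gapLabel q c.1 c.2 = gapLabel q c'.1 c'.2 := by
  obtain ⟨s, hs, ht, h⟩ := h
  exact gapLabel_eq_of_slice hs ht rfl (Nat.le_of_lt_succ c.2.2)
    ((Nat.le_of_lt_succ c'.2.2).trans_eq ((congrArg _ ht).trans (strandsAt_succ hs))) h

/-- The face containing interval number `i` at height `t`. -/
def faceAt (q t i : ℕ) (ht : t < (torusLink q).word.length + 1)
    (hi : i < strandsAt (torusLink q).word t + 1) : Face (torusLink q).word :=
  Quot.mk _ ⟨⟨t, ht⟩, ⟨i, hi⟩⟩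

theorem faceAt_succ {q t i i' : ℕ} {ht hi ht' hi'} (s : Slice)
    (hs : (torusLink q).word[t]? = some s)
    (h : (i ≤ s.pos ∧ i' = i) ∨ ∃ d, i = s.pos + s.kind.top + d ∧ i' = s.pos + s.kind.bot + d) :
    faceAt q (t + 1) i' ht' hi' = faceAt q t i ht hi :=
  (Quot.sound ⟨s, hs, rfl, h⟩).symm

theorem faceAt_zero (q t : ℕ) (ht hi) :
    faceAt q t 0 ht hi = faceAt q 0 0 (by omega) (by omega) := by
  induction t with
  | zero => rfl
  | succ t ih =>
    rw [← ih (by omega) (by omega)]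
    have hs : t < (torusLink q).word.length := by omega
    exact faceAt_succ _ (List.getElem?_eq_getElem hs) (.inl ⟨Nat.zero_le _, rfl⟩)

theorem strandsAt_torusLink_middle {q t : ℕ} (h2 : 2 ≤ t) (h : t ≤ q + 2) :
    strandsAt (torusLink q).word t = 4 := by
  have := strandsAt_torusLink (q := q) (t := t) (by omega)
  omega

/-- All crossings involve only the two leftmost strands, so the regions to their right run straight
down past the whole braid. -/
theorem faceAt_middle (q t i : ℕ) (hi2 : 2 ≤ i) (h2 : 2 ≤ t) (h : t ≤ q + 2) (ht hi) :
    faceAt q t i ht hi = faceAt q 2 i (by rw [torusLink_word_length]; omega)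
      (by rw [strandsAt_torusLink_middle h2 h] at hi
          rwa [strandsAt_torusLink_middle le_rfl (by omega)]) := by
  induction t, h2 using Nat.le_induction with
  | base => rfl
  | succ t h2 ih =>
    rw [strandsAt_torusLink_middle (by omega) h] at hi
    rw [← ih (by omega) (by omega) (by rw [strandsAt_torusLink_middle h2 (by omega)]; omega)]
    refine faceAt_succ (cross true 0) ?_ (.inr ⟨i - 2, ?_⟩)
    · rw [torusLink_word_getElem?]
      split_ifs <;> first | rfl | omega
    · simp only [Kind.top, Kind.bot]
      omega

/-- The converse of the invariance of labels: intervals with equal labels are joined by a chain of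
regions. The outside face is followed along the left edge and around the right, the shaded face `q`
over the top and under the bottom of the inner face, and a bigon is a single interval. For `q ≥ 1`
the label `q` of that shaded face differs from `0`. -/
theorem exists_forall_faceAt_eq {q : ℕ} (hq : 1 ≤ q) (l : ℕ) : ∃ f : Face (torusLink q).word,
    ∀ t i ht hi, gapLabel q t i = l → faceAt q t i ht hi = f := by
  have hlen := torusLink_word_length q
  have hs0 : strandsAt (torusLink q).word 0 = 0 := rfl
  have hs1 : strandsAt (torusLink q).word 1 = 2 := rfl
  have hs2 : strandsAt (torusLink q).word 2 = 4 := rfl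
  have hs3 : strandsAt (torusLink q).word (q + 2) = 4 :=
    strandsAt_torusLink_middle (by omega) le_rfl
  have hs4 : strandsAt (torusLink q).word (q + 3) = 2 := by
    have := strandsAt_torusLink (q := q) (t := q + 3) (by omega)
    omega
  have hw2 : (torusLink q).word[q + 2]? = some (death 1) := by
    simp [torusLink_word_getElem?]
  have hw3 : (torusLink q).word[q + 3]? = some (death 0) := by
    simp [torusLink_word_getElem?]
  have e12 : faceAt q 1 2 (by omega) (by omega) = faceAt q 0 0 (by omega) (by omega) :=
    faceAt_succ (birth 0) rfl (.inr ⟨0, rfl, rfl⟩)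
  have e24 : faceAt q 2 4 (by omega) (by omega) = faceAt q 1 2 (by omega) (by omega) :=
    faceAt_succ (birth 1) rfl (.inr ⟨1, rfl, rfl⟩)
  have e32 : faceAt q (q + 3) 2 (by omega) (by omega) =
      faceAt q (q + 2) 4 (by omega) (by omega) := faceAt_succ _ hw2 (.inr ⟨1, rfl, rfl⟩)
  have e23 : faceAt q 2 3 (by omega) (by omega) = faceAt q 1 1 (by omega) (by omega) :=
    faceAt_succ (birth 1) rfl (.inr ⟨0, rfl, rfl⟩)
  have e21 : faceAt q 2 1 (by omega) (by omega) = faceAt q 1 1 (by omega) (by omega) :=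
    faceAt_succ (birth 1) rfl (.inl ⟨le_rfl, rfl⟩)
  have e31 : faceAt q (q + 3) 1 (by omega) (by omega) =
      faceAt q (q + 2) 3 (by omega) (by omega) := faceAt_succ _ hw2 (.inr ⟨0, rfl, rfl⟩)
  have e31' : faceAt q (q + 3) 1 (by omega) (by omega) =
      faceAt q (q + 2) 1 (by omega) (by omega) := faceAt_succ _ hw2 (.inl ⟨le_rfl, rfl⟩)
  have hm3 := faceAt_middle q (q + 2) 3 (by omega) (by omega) le_rfl (by omega) (by omega)
  have hm4 := faceAt_middle q (q + 2) 4 (by omega) (by omega) le_rfl (by omega) (by omega)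
  have cases_t (t i : ℕ) (ht : t < (torusLink q).word.length + 1)
      (hi : i < strandsAt (torusLink q).word t + 1) :
      i = 0 ∨ (t = 1 ∧ i ≤ 2) ∨ (2 ≤ t ∧ t ≤ q + 2 ∧ i ≤ 4) ∨ (t = q + 3 ∧ i ≤ 2) := by
    have := strandsAt_torusLink (q := q) (t := t) (by omega)
    omega
  by_cases h0 : l = 0
  · refine ⟨faceAt q 0 0 (by omega) (by omega), fun t i ht hi h => ?_⟩
    have hl := gapLabel_cases q t i
    rw [h] at hl
    rcases cases_t t i ht hi with rfl | ⟨rfl, h'⟩ | ⟨h2, ht', h'⟩ | ⟨rfl, h'⟩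
    · exact faceAt_zero ..
    · obtain rfl | rfl : i = 0 ∨ i = 2 := by omega
      · exact faceAt_zero ..
      · exact e12
    · obtain rfl | rfl : i = 0 ∨ i = 4 := by omega
      · exact faceAt_zero ..
      · rw [faceAt_middle q t 4 (by omega) h2 ht' ht hi, e24, e12]
    · obtain rfl | rfl : i = 0 ∨ i = 2 := by omega
      · exact faceAt_zero ..
      · rw [e32, hm4, e24, e12]
  by_cases h1 : l = q + 1
  · refine ⟨faceAt q 2 2 (by omega) (by omega), fun t i ht hi h => ?_⟩
    have hl := gapLabel_cases q t i
    rw [h] at hl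
    obtain ⟨rfl, h2, h'⟩ : i = 2 ∧ 2 ≤ t ∧ t ≤ q + 2 := by
      omega
    exact faceAt_middle q t 2 le_rfl h2 h' ht hi
  by_cases h2 : l = q
  · refine ⟨faceAt q 2 3 (by omega) (by omega), fun t i ht hi h => ?_⟩
    have hl := gapLabel_cases q t i
    rw [h] at hl
    rcases cases_t t i ht hi with rfl | ⟨rfl, h'⟩ | ⟨h2, ht', h'⟩ | ⟨rfl, h'⟩
    · omega
    · obtain rfl : i = 1 := by omega
      exact e23.symm
    · obtain ⟨rfl, rfl⟩ | ⟨rfl, rfl⟩ | rfl : (i = 1 ∧ t = 2) ∨ (i = 1 ∧ t = q + 2) ∨ i = 3 := by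
        omega
      · rw [e21, e23]
      · rw [← e31', e31, hm3]
      · exact faceAt_middle q t 3 (by omega) h2 ht' ht hi
    · obtain rfl : i = 1 := by omega
      rw [e31, hm3]
  by_cases h3 : l < q
  · refine ⟨faceAt q (l + 2) 1 (by omega)
      (by rw [strandsAt_torusLink_middle (by omega) (by omega)]; omega), fun t i ht hi h => ?_⟩
    have hl := gapLabel_cases q t i
    rw [h] at hl
    obtain ⟨rfl, rfl⟩ : i = 1 ∧ t = l + 2 := by omega
    rfl
  -- No interval has a label above `q + 1`, so any face will do.
  · refine ⟨faceAt q 0 0 (by omega) (by omega), fun t i ht hi h => ?_⟩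
    have hl := gapLabel_cases q t i
    rw [h] at hl
    omega

/-- The number of a face of the torus link diagram. -/
def faceLabel {q : ℕ} : Face (torusLink q).word → ℕ :=
  Quot.lift (fun c => gapLabel q c.1 c.2) fun _ _ h => h.gapLabel_eq

theorem faceLabel_injective {q : ℕ} (hq : 1 ≤ q) : Function.Injective (faceLabel (q := q)) := by
  rintro ⟨c⟩ ⟨c'⟩ h
  obtain ⟨f, hf⟩ := exists_forall_faceAt_eq hq (gapLabel q c.1 c.2)
  exact (hf c.1 c.2 c.1.2 c.2.2 rfl).trans (hf c'.1 c'.2 c'.1.2 c'.2.2 h.symm).symm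

theorem exists_gap {q t i : ℕ} (ht : t ≤ q + 4)
    (hi : i ≤ strandsAt (torusLink q).word t) :
    ∃ c : Gap (torusLink q).word, (c.1 : ℕ) = t ∧ (c.2 : ℕ) = i :=
  ⟨⟨⟨t, by rw [torusLink_word_length]; omega⟩,
    ⟨i, Nat.lt_succ_of_le hi⟩⟩, rfl, rfl⟩

/-- This turns the geometric conditions in `Beside` and `Touches` into equations between labels. -/
theorem gap_eq_faceLabel_iff {q t i : ℕ} (hq : 1 ≤ q) (ht : t ≤ q + 4)
    (hi : i ≤ strandsAt (torusLink q).word t) (f : Face (torusLink q).word) :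
    (∃ c : Gap (torusLink q).word, Quot.mk _ c = f ∧ (c.1 : ℕ) = t ∧ (c.2 : ℕ) = i) ↔
      faceLabel f = gapLabel q t i := by
  constructor
  · rintro ⟨c, rfl, rfl, rfl⟩
    rfl
  · intro h
    obtain ⟨c, rfl, rfl⟩ := exists_gap ht hi
    exact ⟨c, faceLabel_injective hq h.symm, rfl, rfl⟩

theorem beside_torusLink {q : ℕ} (hq : 1 ≤ q) (f : Face (torusLink q).word) :
    Beside 2 2 f ↔ q ≤ faceLabel f := by
  have h2 := gap_eq_faceLabel_iff (q := q) (t := 2) (i := 2) hq (by omega) (show 2 ≤ 4 by omega) f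
  have h3 := gap_eq_faceLabel_iff (q := q) (t := 2) (i := 3) hq (by omega) (show 3 ≤ 4 by omega) f
  have hl : Beside 2 2 f ↔ faceLabel f = gapLabel q 2 2 ∨ faceLabel f = gapLabel q 2 3 := by
    rw [← h2, ← h3, Beside, ← exists_or]
    exact exists_congr fun c => by tauto
  have hb : faceLabel f ≤ q + 1 := by
    obtain ⟨c, rfl⟩ := Quot.exists_rep f
    change gapLabel q c.1 c.2 ≤ q + 1
    have := gapLabel_cases q c.1 c.2
    omega
  have := gapLabel_cases q 2 2
  have := gapLabel_cases q 2 3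
  rw [hl]
  omega

theorem torusLink_word_get {q t : ℕ} (ht : t < (torusLink q).word.length) (h2 : 2 ≤ t)
    (h : t < q + 2) : (torusLink q).word.get ⟨t, ht⟩ = cross true 0 := by
  have hs := torusLink_word_getElem? q t
  rw [List.getElem?_eq_getElem ht, if_neg (by omega), if_neg (by omega), if_pos h] at hs
  exact Option.some.inj hs

/-- The crossings of the torus link diagram. -/
noncomputable def crossingEquiv (q : ℕ) : Fin q ≃ Crossing (torusLink q).word :=
  Equiv.ofBijective
    (fun j => ⟨⟨j + 2, by rw [torusLink_word_length]; omega⟩, true, by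
      rw [torusLink_word_get _ (by omega) (by omega)]⟩) <| by
    constructor
    · intro i j h
      simpa [Fin.ext_iff] using h
    · rintro ⟨⟨t, ht⟩, ε, h⟩
      have hs := torusLink_slice_cases (List.getElem?_eq_getElem ht)
      rw [List.get_eq_getElem] at h
      obtain ⟨h2, ht'⟩ : 2 ≤ t ∧ t < q + 2 := by
        rcases hs with ⟨-, hs⟩ | ⟨-, hs⟩ | ⟨h2, h', -⟩ | ⟨-, hs⟩ | ⟨-, hs⟩
        · simp [hs] at h
        · simp [hs] at h
        · exact ⟨h2, h'⟩
        · simp [hs] at h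
        · simp [hs] at h
      refine ⟨⟨t - 2, by omega⟩, ?_⟩
      ext
      simp only
      omega

@[simp] theorem crossingEquiv_val {q : ℕ} (j : Fin q) : ((crossingEquiv q j).1 : ℕ) = j + 2 := rfl

theorem crossingEquiv_pos {q : ℕ} (j : Fin q) :
    ((torusLink q).word.get (crossingEquiv q j).1).pos = 0 :=
  congrArg Slice.pos (torusLink_word_get (crossingEquiv q j).1.2 (by simp) (by simp))

/-- The corners to the left, above and below carry the labels `0`, `j` and `j + 1`; the right corner
is the omitted inner face. At the two ends of the braid, the corner above the first crossing and the
one below the last lie in the other omitted face. The formula still holds there: `j = 0` merges with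
the outside face and `j + 1 = q` is excluded by `hf`. -/
theorem touches_torusLink {q : ℕ} (j : Fin q) {f : Face (torusLink q).word}
    (hf : faceLabel f < q) :
    Touches (crossingEquiv q j) f ↔
      faceLabel f = 0 ∨ faceLabel f = j ∨ faceLabel f = j + 1 := by
  have hj := j.2
  have hs := strandsAt_torusLink (q := q) (t := j + 2) (by omega)
  have hs' := strandsAt_torusLink (q := q) (t := j + 3) (by omega)
  have b0 : 2 ≤ strandsAt (torusLink q).word (j + 2) := by omega
  have b1 : 1 ≤ strandsAt (torusLink q).word (j + 3) := by omega
  have hq : 1 ≤ q := by omega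
  have b2 : (j : ℕ) + 3 ≤ q + 4 := by omega
  have h0 := gap_eq_faceLabel_iff hq (Nat.le_of_succ_le b2) (Nat.zero_le _) f
  have h1 := gap_eq_faceLabel_iff hq (Nat.le_of_succ_le b2) (Nat.le_of_succ_le b0) f
  have h2 := gap_eq_faceLabel_iff hq (Nat.le_of_succ_le b2) b0 f
  have h3 := gap_eq_faceLabel_iff hq b2 b1 f
  have hl : Touches (crossingEquiv q j) f ↔ faceLabel f = gapLabel q (j + 2) 0 ∨
      faceLabel f = gapLabel q (j + 2) 1 ∨ faceLabel f = gapLabel q (j + 2) 2 ∨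
      faceLabel f = gapLabel q (j + 3) 1 := by
    rw [← h0, ← h1, ← h2, ← h3, Touches, ← exists_or, ← exists_or, ← exists_or]
    refine exists_congr fun c => ?_
    rw [crossingEquiv_pos, crossingEquiv_val]
    simp only [and_or_left, or_assoc, zero_add]
  have g0 := gapLabel_cases q (j + 2) 0
  have g1 := gapLabel_cases q (j + 2) 1
  have g2 := gapLabel_cases q (j + 2) 2
  have g3 := gapLabel_cases q (j + 3) 1
  rw [hl]
  clear h0 h1 h2 h3 hl hs hs'
  omega

theorem exists_faceLabel_eq {q l : ℕ} (hl : l < q) :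
    ∃ f : Face (torusLink q).word, faceLabel f = l := by
  have key (t i : ℕ) (ht : t ≤ q + 4) (hi : i ≤ strandsAt (torusLink q).word t) :
      ∃ f : Face (torusLink q).word, faceLabel f = gapLabel q t i :=
    ⟨faceAt q t i (by rw [torusLink_word_length]; omega) (by omega), rfl⟩
  by_cases h : l = 0
  · simpa [gapLabel, h] using key 0 0 (by omega) (by omega)
  · have hs := strandsAt_torusLink (q := q) (t := l + 2) (by omega)
    have hg := gapLabel_cases q (l + 2) 1
    obtain ⟨f, hf⟩ := key (l + 2) 1 (by omega) (by omega)
    exact ⟨f, by omega⟩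

theorem shaded_iff_of_faceLabel_lt {q : ℕ} {f : Face (torusLink q).word} (hf : faceLabel f < q) :
    Shaded f ↔ faceLabel f ≠ 0 := by
  obtain ⟨⟨⟨t, ht⟩, ⟨i, hi⟩⟩, rfl⟩ := Quot.exists_rep f
  change gapLabel q t i < q at hf
  change Odd i ↔ gapLabel q t i ≠ 0
  have := gapLabel_cases q t i
  rw [Nat.odd_iff]
  omega

/-- The faces of the torus link diagram other than the two omitted ones. -/
noncomputable def taitFaceEquiv (n : ℕ) : Fin (n + 1) ≃ TaitFace (torusLink (n + 1)).word 2 2 :=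
  (Equiv.ofBijective
    (fun f : TaitFace (torusLink (n + 1)).word 2 2 =>
      (⟨faceLabel f.1, not_le.1 fun h => f.2 ((beside_torusLink (by omega) _).2 h)⟩ : Fin (n + 1)))
    ⟨fun f f' h => Subtype.ext (faceLabel_injective (by omega) (Fin.ext_iff.1 h)), fun l => by
      obtain ⟨f, hf⟩ := exists_faceLabel_eq l.2
      refine ⟨⟨f, fun h => ?_⟩, Fin.ext hf⟩
      have := (beside_torusLink (by omega) f).1 h
      omega⟩).symm

@[simp] theorem faceLabel_taitFaceEquiv {n : ℕ} (l : Fin (n + 1)) :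
    faceLabel (taitFaceEquiv n l).1 = l :=
  Fin.ext_iff.1 ((taitFaceEquiv n).symm_apply_apply l)

theorem touches_taitFaceEquiv {n : ℕ} (j l : Fin (n + 1)) :
    Touches (crossingEquiv (n + 1) j) (taitFaceEquiv n l).1 ↔
      (l : ℕ) = 0 ∨ (l : ℕ) = j ∨ (l : ℕ) = j + 1 := by
  rw [touches_torusLink j (by rw [faceLabel_taitFaceEquiv]; exact l.2), faceLabel_taitFaceEquiv]

theorem crossingEquiv_le_iff {q : ℕ} {i j : Fin q} :
    crossingEquiv q i ≤ crossingEquiv q j ↔ i ≤ j := by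
  rw [← Subtype.coe_le_coe, Fin.le_def, Fin.le_def, crossingEquiv_val, crossingEquiv_val]
  omega

/-- The letters of the torus link diagram in terms of the numbers of crossings and faces. -/
def torusLetter (j l : ℕ) : Letter :=
  if l = 0 then if j = 0 then .ell else .d else if l = j + 1 then .L else .D

theorem letter_taitFaceEquiv {n : ℕ} (j l : Fin (n + 1))
    (h : Touches (crossingEquiv (n + 1) j) (taitFaceEquiv n l).1) :
    letter (crossingEquiv (n + 1) j) (taitFaceEquiv n l).1 = torusLetter j l := by
  rw [touches_taitFaceEquiv] at h
  have hfirst : (∀ v', Touches v' (taitFaceEquiv n l).1 → crossingEquiv (n + 1) j ≤ v') ↔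
      if (l : ℕ) = 0 then (j : ℕ) = 0 else (l : ℕ) = j + 1 := by
    rw [(crossingEquiv (n + 1)).forall_congr_right.symm]
    simp only [touches_taitFaceEquiv, crossingEquiv_le_iff]
    split_ifs with h0
    · constructor
      · intro h
        have := h 0 (by omega)
        rw [Fin.le_def, Fin.val_zero] at this
        omega
      · intro h i _
        rw [Fin.le_def]
        omega
    · constructor
      · intro h'
        -- The crossing at the top of the bigon `l` has number `l - 1`.
        have := h' ⟨l - 1, by omega⟩ (by simp only; omega)
        rw [Fin.le_def] at this
        simp only at this
        omega
      · intro h i hi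
        rw [Fin.le_def]
        omega
  simp only [letter, hfirst, torusLetter, shaded_iff_of_faceLabel_lt (f := (taitFaceEquiv n l).1)
    (by rw [faceLabel_taitFaceEquiv]; exact l.2), faceLabel_taitFaceEquiv]
  split_ifs <;> first | rfl | omega

/-! ### Perfect matchings as permutations -/

section Matching

variable {w : List Slice} {t g : ℕ} {ι : Type*} [Fintype ι]

open Classical in
/-- The set of edges which matches the crossing number `i` with the face number `σ i`. -/
noncomputable def matchingOfPerm (c : ι ≃ Crossing w) (f : ι ≃ TaitFace w t g)
    (σ : Equiv.Perm ι) : Finset (Crossing w × TaitFace w t g) :=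
  Finset.univ.image fun i => (c i, f (σ i))

theorem mem_matchingOfPerm {c : ι ≃ Crossing w} {f : ι ≃ TaitFace w t g} {σ : Equiv.Perm ι}
    {e : Crossing w × TaitFace w t g} :
    e ∈ matchingOfPerm c f σ ↔ f (σ (c.symm e.1)) = e.2 := by
  simp only [matchingOfPerm, Finset.mem_image, Finset.mem_univ, true_and]
  constructor
  · rintro ⟨i, rfl⟩
    simp
  · intro h
    exact ⟨c.symm e.1, by simp [h]⟩

theorem isPerfectMatching_matchingOfPerm {c : ι ≃ Crossing w} {f : ι ≃ TaitFace w t g}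
    {σ : Equiv.Perm ι} (h : ∀ i, Touches (c i) (f (σ i)).1) :
    IsPerfectMatching (matchingOfPerm c f σ) := by
  refine ⟨fun e he => ?_, fun v => ?_, fun l => ?_⟩
  · rw [mem_matchingOfPerm] at he
    simpa [he] using h (c.symm e.1)
  · simp [mem_matchingOfPerm]
  · refine ⟨c (σ.symm (f.symm l)), by simp [mem_matchingOfPerm], fun v hv => ?_⟩
    obtain rfl : f (σ (c.symm v)) = l := mem_matchingOfPerm.1 hv
    simp

theorem matchingOfPerm_injective (c : ι ≃ Crossing w) (f : ι ≃ TaitFace w t g) :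
    Function.Injective (matchingOfPerm c f) := by
  intro σ τ h
  ext i
  have hi : (c i, f (σ i)) ∈ matchingOfPerm c f τ := by
    rw [← h, mem_matchingOfPerm, c.symm_apply_apply]
  rw [mem_matchingOfPerm, c.symm_apply_apply] at hi
  exact (f.injective hi).symm

theorem IsPerfectMatching.exists_eq_matchingOfPerm (c : ι ≃ Crossing w) (f : ι ≃ TaitFace w t g)
    {M : Finset (Crossing w × TaitFace w t g)} (hM : IsPerfectMatching M) :
    ∃ σ : Equiv.Perm ι, matchingOfPerm c f σ = M := by
  obtain ⟨-, hv, hf⟩ := hM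
  choose s hs hs' using hv
  have hbij : Function.Bijective s := by
    constructor
    · intro v v' h
      exact (hf (s v)).unique (hs v) (h ▸ hs v')
    · intro l
      obtain ⟨v, hv, -⟩ := hf l
      exact ⟨v, (hs' v l hv).symm⟩
  refine ⟨(c.trans (Equiv.ofBijective s hbij)).trans f.symm, ?_⟩
  ext ⟨v, l⟩
  rw [mem_matchingOfPerm]
  simp only [Equiv.trans_apply, Equiv.apply_symm_apply, Equiv.ofBijective_apply]
  exact ⟨fun h => h ▸ hs v, fun h => (hs' v l h).symm⟩

/-- The matching polynomial is the permanent of the adjacency matrix. -/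
theorem matchingPolynomial_eq_sum_perm [DecidableEq ι] (c : ι ≃ Crossing w) (f : ι ≃ TaitFace w t g) :
    matchingPolynomial w t g =
      ∑ σ : Equiv.Perm ι, ∏ i, adjacencyMatrix w t g (c i) (f (σ i)) := by
  classical
  rw [← Finset.sum_filter_of_ne (p := fun σ : Equiv.Perm ι => ∀ i, Touches (c i) (f (σ i)).1)]
  · rw [matchingPolynomial]
    symm
    refine Finset.sum_bij (fun σ _ => matchingOfPerm c f σ) (fun σ hσ => ?_)
      (fun σ _ τ _ h => matchingOfPerm_injective c f h) (fun M hM => ?_) (fun σ hσ => ?_)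
    · exact Finset.mem_filter.2
        ⟨Finset.mem_univ _, isPerfectMatching_matchingOfPerm (Finset.mem_filter.1 hσ).2⟩
    · have hM' := (Finset.mem_filter.1 hM).2
      obtain ⟨σ, rfl⟩ := hM'.exists_eq_matchingOfPerm c f
      refine ⟨σ, Finset.mem_filter.2 ⟨Finset.mem_univ _, fun i => ?_⟩, rfl⟩
      exact hM'.1 (c i, f (σ i)) (by rw [mem_matchingOfPerm, c.symm_apply_apply])
    · rw [matchingOfPerm, Finset.prod_image fun i _ j _ h => c.injective (Prod.ext_iff.1 h).1]
      exact Finset.prod_congr rfl fun i _ => if_pos ((Finset.mem_filter.1 hσ).2 i)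
  · intro σ _ h i
    by_contra hi
    exact h (Finset.prod_eq_zero (Finset.mem_univ i) (if_neg hi))

end Matching

/-! ### The determinant -/

/-- A permutation that maps all numbers but one to themselves or their successor, and the remaining
one to `0`, is a cycle. -/
theorem perm_eq_cycleRange {n : ℕ} {σ : Equiv.Perm (Fin (n + 1))}
    (h : ∀ i, (σ i : ℕ) = 0 ∨ (σ i : ℕ) = i ∨ (σ i : ℕ) = i + 1) :
    σ = Fin.cycleRange (σ.symm 0) := by
  set k := σ.symm 0 with hk
  have hσk : σ k = 0 := σ.apply_symm_apply 0
  have hne (i : Fin (n + 1)) (hi : i ≠ k) : (σ i : ℕ) ≠ 0 := fun h' =>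
    hi (σ.injective (Fin.ext (by simpa [hσk] using h')))
  -- Upward induction: before `k` the value `0` is not available, and the value `i` is already taken
  -- by the predecessor.
  have hlt (i : ℕ) : ∀ hi : i < n + 1, i < (k : ℕ) → (σ ⟨i, hi⟩ : ℕ) = i + 1 := by
    induction i with
    | zero =>
      intro hi hik
      have h1 := h ⟨0, hi⟩
      have h2 := hne ⟨0, hi⟩ (fun h' => by simp [← h'] at hik)
      simp only at h1
      omega
    | succ i ih =>
      intro hi hik
      have h1 := h ⟨i + 1, hi⟩
      have h2 := hne ⟨i + 1, hi⟩ (fun h' => by simp [← h'] at hik)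
      have h3 := ih (by omega) (by omega)
      have h4 : (σ ⟨i + 1, hi⟩ : ℕ) ≠ i + 1 := fun h' => by
        have := σ.injective (Fin.ext (h'.trans h3.symm))
        simp at this
      simp only at h1
      omega
  -- Downward induction from the last index, with `d = n - i`: the value `i + 1` is out of range at
  -- the top and otherwise taken by the successor.
  have hgt (d : ℕ) : ∀ i (hi : i < n + 1), i + d = n → (k : ℕ) < i → (σ ⟨i, hi⟩ : ℕ) = i := by
    induction d with
    | zero =>
      intro i hi hin hik
      have h1 := h ⟨i, hi⟩
      have h2 := hne ⟨i, hi⟩ (fun h' => by simp [← h'] at hik)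
      have h3 := (σ ⟨i, hi⟩).2
      simp only at h1
      omega
    | succ d ih =>
      intro i hi hin hik
      have h1 := h ⟨i, hi⟩
      have h2 := hne ⟨i, hi⟩ (fun h' => by simp [← h'] at hik)
      have h3 := ih (i + 1) (by omega) (by omega) (by omega)
      have h4 : (σ ⟨i, hi⟩ : ℕ) ≠ i + 1 := fun h' => by
        have := σ.injective (Fin.ext (h'.trans h3.symm))
        simp at this
      simp only at h1
      omega
  ext i
  rcases lt_trichotomy i k with hi | rfl | hi
  · rw [Fin.coe_cycleRange_of_lt hi]
    exact hlt i i.2 hi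
  · rw [hσk, Fin.cycleRange_self]
  · rw [Fin.cycleRange_of_gt hi]
    exact hgt (n - i) i i.2 (by omega) hi

theorem cycleRange_val_cases {n : ℕ} (k i : Fin (n + 1)) :
    (i < k ∧ (Fin.cycleRange k i : ℕ) = i + 1) ∨ (i = k ∧ (Fin.cycleRange k i : ℕ) = 0) ∨
      (k < i ∧ (Fin.cycleRange k i : ℕ) = i) := by
  rcases lt_trichotomy i k with hi | rfl | hi
  · exact .inl ⟨hi, Fin.coe_cycleRange_of_lt hi⟩
  · exact .inr (.inl ⟨rfl, by rw [Fin.cycleRange_self]; rfl⟩)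
  · exact .inr (.inr ⟨hi, by rw [Fin.cycleRange_of_gt hi]⟩)

theorem cycleRange_eq_zero_iff {n : ℕ} (k i : Fin (n + 1)) : Fin.cycleRange k i = 0 ↔ i = k := by
  rw [← Fin.cycleRange_self k, (Fin.cycleRange k).injective.eq_iff]

theorem cycleRange_injective (n : ℕ) :
    Function.Injective (Fin.cycleRange : Fin (n + 1) → Equiv.Perm (Fin (n + 1))) := by
  intro k l h
  have := cycleRange_eq_zero_iff l k
  rw [← h, Fin.cycleRange_self] at this
  exact this.1 rfl

/-- The adjacency matrix in terms of the numbers of crossings and faces. -/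
theorem adjacencyMatrix_torusLink {n : ℕ} (j l : Fin (n + 1)) :
    adjacencyMatrix (torusLink (n + 1)).word 2 2 (crossingEquiv (n + 1) j) (taitFaceEquiv n l) =
      if (l : ℕ) = 0 ∨ (l : ℕ) = j ∨ (l : ℕ) = j + 1 then MvPolynomial.X (torusLetter j l)
      else 0 := by
  rw [adjacencyMatrix]
  by_cases h : Touches (crossingEquiv (n + 1) j) (taitFaceEquiv n l).1
  · rw [if_pos h, if_pos ((touches_taitFaceEquiv j l).1 h), letter_taitFaceEquiv j l h]
  · rw [if_neg h, if_neg (mt (touches_taitFaceEquiv j l).2 h)]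

/-- A sum over all permutations whose terms vanish unless every crossing touches its face. -/
theorem sum_perm_eq_sum_cycleRange {n : ℕ} {R : Type*} [CommRing R]
    (F : Equiv.Perm (Fin (n + 1)) → R)
    (hF : ∀ σ i, ¬ ((σ i : ℕ) = 0 ∨ (σ i : ℕ) = (i : Fin (n + 1)) ∨ (σ i : ℕ) = i + 1) → F σ = 0) :
    ∑ σ, F σ = ∑ k, F (Fin.cycleRange k) := by
  symm
  refine Fintype.sum_of_injective _ (cycleRange_injective n) _ _ (fun σ hσ => ?_) fun _ => rfl
  by_contra h
  refine hσ ⟨σ.symm 0, (perm_eq_cycleRange fun i => ?_).symm⟩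
  by_contra hi
  exact h (hF σ i hi)

theorem prod_adjacencyMatrix_eq_zero {n : ℕ} {σ : Equiv.Perm (Fin (n + 1))} {i : Fin (n + 1)}
    (h : ¬ ((σ i : ℕ) = 0 ∨ (σ i : ℕ) = i ∨ (σ i : ℕ) = i + 1)) :
    ∏ i, adjacencyMatrix (torusLink (n + 1)).word 2 2 (crossingEquiv (n + 1) i)
      (taitFaceEquiv n (σ i)) = 0 :=
  Finset.prod_eq_zero (Finset.mem_univ i) (by rw [adjacencyMatrix_torusLink, if_neg h])

theorem matchingPolynomial_torusLink (n : ℕ) :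
    matchingPolynomial (torusLink (n + 1)).word 2 2 =
      ∑ k : Fin (n + 1), ∏ i : Fin (n + 1), MvPolynomial.X (torusLetter i (Fin.cycleRange k i)) := by
  rw [matchingPolynomial_eq_sum_perm (crossingEquiv (n + 1)) (taitFaceEquiv n),
    sum_perm_eq_sum_cycleRange _ fun σ i h => prod_adjacencyMatrix_eq_zero h]
  refine Finset.sum_congr rfl fun k _ => Finset.prod_congr rfl fun i _ => ?_
  rw [adjacencyMatrix_torusLink, if_pos]
  have := cycleRange_val_cases k i
  tauto

/-- Only the cycles `Fin.cycleRange k` contribute, and each uses exactly one entry of the outside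
column, the one in row `k`. Giving this entry the sign of its cycle cancels the sign in the
determinant. -/
theorem exists_det_eq_matchingPolynomial (n : ℕ) :
    ∃ (ε : Crossing (torusLink (n + 1)).word → TaitFace (torusLink (n + 1)).word 2 2 → ℤˣ)
      (e : Crossing (torusLink (n + 1)).word ≃ TaitFace (torusLink (n + 1)).word 2 2),
      (Matrix.of fun v v' : Crossing (torusLink (n + 1)).word =>
          (ε v (e v') : ℤ) • adjacencyMatrix (torusLink (n + 1)).word 2 2 v (e v')).det =
        matchingPolynomial (torusLink (n + 1)).word 2 2 := by
  classical
  set c := crossingEquiv (n + 1)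
  set f := taitFaceEquiv n
  refine ⟨fun v l => if f.symm l = 0 then Equiv.Perm.sign (Fin.cycleRange (c.symm v)) else 1,
    c.symm.trans f, ?_⟩
  rw [← Matrix.det_submatrix_equiv_self c, ← Matrix.det_transpose, Matrix.det_apply',
    matchingPolynomial_eq_sum_perm c f]
  simp only [Matrix.transpose_apply, Matrix.submatrix_apply, Matrix.of_apply, Equiv.trans_apply,
    Equiv.symm_apply_apply, zsmul_eq_mul, Finset.prod_mul_distrib]
  rw [sum_perm_eq_sum_cycleRange _ fun σ i h => by
      rw [prod_adjacencyMatrix_eq_zero h, mul_zero, mul_zero],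
    sum_perm_eq_sum_cycleRange _ fun σ i h => prod_adjacencyMatrix_eq_zero h]
  refine Finset.sum_congr rfl fun k _ => ?_
  rw [Finset.prod_eq_single k (fun i _ hi => by simp [cycleRange_eq_zero_iff, hi])
    (fun h => absurd (Finset.mem_univ k) h), Fin.cycleRange_self, if_pos rfl, ← mul_assoc,
    ← Int.cast_mul, ← Units.val_mul, Int.units_mul_self, Units.val_one, Int.cast_one, one_mul]

/-! ### The specialised matching polynomial -/

/-- The specialised letter at the crossing number `i` in the matching number `k`. -/
noncomputable def matchingWeight (k i : ℕ) : Laurent :=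
  if i < k then mono 1 0 else if i = 0 ∧ k = 0 then mono (-1) 0 else mono 0 1

theorem P_succ (n : ℕ) : P (n + 1) =
    ∑ k ∈ Finset.range (n + 1), ∏ i ∈ Finset.range (n + 1), matchingWeight k i := by
  rw [P, matchingPolynomial_torusLink, map_sum,
    ← Fin.sum_univ_eq_sum_range fun k => ∏ i ∈ Finset.range (n + 1), matchingWeight k i]
  refine Finset.sum_congr rfl fun k _ => ?_
  rw [map_prod, ← Fin.prod_univ_eq_prod_range (matchingWeight k)]
  refine Finset.prod_congr rfl fun i _ => ?_
  rw [MvPolynomial.aeval_X, matchingWeight]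
  rcases cycleRange_val_cases k i with ⟨h, h'⟩ | ⟨rfl, h'⟩ | ⟨h, h'⟩
  · rw [h', if_pos (Fin.lt_def.1 h), torusLetter, if_neg (by omega), if_pos rfl, specialize]
  · rw [h', if_neg (lt_irrefl _), torusLetter, if_pos rfl]
    split_ifs <;> first | rfl | omega
  · have := Fin.lt_def.1 h
    rw [h', torusLetter, if_neg (by omega), if_neg (by omega), if_neg (by omega),
      if_neg (by omega), specialize]

theorem mono_pow (i j : ℤ) (n : ℕ) : mono i j ^ n = mono (n * i) (n * j) := by
  induction n with
  | zero => simp [mono_zero]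
  | succ n ih => rw [pow_succ, ih, mono_mul_mono]; push_cast; ring_nf

theorem P_one : P 1 = mono (-1) 0 := by
  simp [P_succ 0, matchingWeight]

/-- The matchings with `k ≤ n` extend by a letter `D` or `d` at the new last crossing, hence the
factor `z`; the new matching `k = n + 1` has weight `a^(n+1) z`. -/
theorem P_add_two (n : ℕ) : P (n + 2) = mono 0 1 * P (n + 1) + mono (n + 1) 1 := by
  rw [P_succ (n + 1), P_succ n, Finset.sum_range_succ, Finset.mul_sum]
  congr 1
  · refine Finset.sum_congr rfl fun k hk => ?_
    rw [Finset.prod_range_succ, mul_comm, matchingWeight, if_neg (by simp at hk; omega),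
      if_neg (by omega)]
  · rw [Finset.prod_range_succ, matchingWeight, if_neg (lt_irrefl _), if_neg (by omega),
      Finset.prod_congr rfl fun i hi => by rw [matchingWeight, if_pos (Finset.mem_range.1 hi)],
      Finset.prod_const, Finset.card_range, mono_pow, mono_mul_mono]
    simp

theorem torusPolynomial_eq {q : ℕ} (hq : 2 ≤ q) :
    torusPolynomial q = P q - ∑ i ∈ Finset.range (q - 1), P i * g (q - 2 - i) :=
  torusPolynomial_eq_of_recursion rfl P_one P_add_two hq

/-! ### The coefficients of the Kauffman polynomials of torus links -/

theorem coeff_mono (i j a b : ℤ) :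
    (mono i j).coeff (a, b) = if a = i ∧ b = j then 1 else 0 := by
  rw [mono, AddMonoidAlgebra.coeff_single, Finsupp.single_apply]
  simp only [Prod.mk.injEq, eq_comm]

/-- The coefficient of `a ^ i * z ^ j` in `torusPolynomial n`. -/
noncomputable def torusCoeff (n : ℕ) (i j : ℤ) : ℤ := (torusPolynomial n).coeff (i, j)

theorem torusCoeff_zero (i j : ℤ) : torusCoeff 0 i j =
    (if i = 1 ∧ j = -1 then 1 else 0) + (if i = -1 ∧ j = -1 then 1 else 0)
      - if i = 0 ∧ j = 0 then 1 else 0 := by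
  rw [torusCoeff, torusPolynomial, delta, add_mul, mono_mul_mono, mono_mul_mono, ← mono_zero,
    AddMonoidAlgebra.coeff_sub, AddMonoidAlgebra.coeff_add, Finsupp.sub_apply, Finsupp.add_apply,
    coeff_mono, coeff_mono, coeff_mono]
  norm_num

theorem torusCoeff_one (i j : ℤ) : torusCoeff 1 i j = if i = -1 ∧ j = 0 then 1 else 0 := by
  rw [torusCoeff, torusPolynomial, coeff_mono]

theorem coeff_z_mul (r : Laurent) (i j : ℤ) :
    (mono 0 1 * r).coeff (i, j) = r.coeff (i, j - 1) := by
  have h : ((i, j) : ℤ × ℤ) = (0, 1) + (i, j - 1) := by simp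
  rw [mono, h, AddMonoidAlgebra.coeff_single_mul_add, one_mul]

theorem torusCoeff_add_two (n : ℕ) (i j : ℤ) : torusCoeff (n + 2) i j =
    torusCoeff (n + 1) i (j - 1) - torusCoeff n i j + if i = n + 1 ∧ j = 1 then 1 else 0 := by
  rw [torusCoeff, torusPolynomial, AddMonoidAlgebra.coeff_add, AddMonoidAlgebra.coeff_sub,
    Finsupp.add_apply, Finsupp.sub_apply, coeff_mono, coeff_z_mul]
  rfl

/-- These degree bounds make all coefficients fit into `q + 1` rows and columns. The clauses `1 < i`
and `0 < j` allow for `delta` and `a⁻¹`, where the bound `n - 1` would be too small. -/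
theorem torusCoeff_eq_zero (n : ℕ) {i j : ℤ}
    (h : i < -1 ∨ (1 < i ∧ (n : ℤ) ≤ i) ∨ j < -1 ∨ (0 < j ∧ (n : ℤ) ≤ j)) :
    torusCoeff n i j = 0 := by
  induction n using torusPolynomial.induct generalizing j with
  | case1 =>
    rw [torusCoeff_zero, if_neg (by omega), if_neg (by omega), if_neg (by omega)]
    rfl
  | case2 => rw [torusCoeff_one, if_neg (by omega)]
  | case3 n ih₁ ih₀ =>
    push_cast at h
    rw [torusCoeff_add_two, ih₁ (by push_cast; omega), ih₀ (by omega), if_neg (by omega)]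
    rfl

/-- The coefficients of `torusPolynomial n`, stored row by row in rows of length `q + 1`. -/
noncomputable def flatCoeff (q n : ℕ) (y : ℤ) : ℤ :=
  torusCoeff n (y / (q + 1) - 1) (y % (q + 1) - 1)

theorem flatCoeff_mul_add {q : ℕ} (n : ℕ) (i : ℤ) {j : ℤ} (h0 : 0 ≤ j) (h : j ≤ q) :
    flatCoeff q n (i * (q + 1) + j) = torusCoeff n (i - 1) (j - 1) := by
  rw [flatCoeff, add_comm, Int.add_mul_ediv_right _ _ (by omega), Int.add_mul_emod_self_right,
    Int.ediv_eq_zero_of_lt h0 (by omega), Int.emod_eq_of_lt h0 (by omega), zero_add]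

theorem exists_eq_mul_add (q : ℕ) (y : ℤ) : ∃ i j : ℤ, 0 ≤ j ∧ j ≤ q ∧ y = i * (q + 1) + j := by
  refine ⟨y / (q + 1), y % (q + 1), Int.emod_nonneg _ (by omega), ?_, ?_⟩
  · have := Int.emod_lt_of_pos y (show (0 : ℤ) < q + 1 by omega)
    omega
  · rw [mul_comm, Int.mul_ediv_add_emod]

theorem flatCoeff_of_neg {q n : ℕ} {y : ℤ} (h : y < 0) : flatCoeff q n y = 0 := by
  have := Int.ediv_lt_of_lt_mul (a := y) (b := 0) (c := q + 1) (by omega) (by omega)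
  exact torusCoeff_eq_zero n (.inl (by omega))

theorem flatCoeff_of_le {q n : ℕ} (hq : 2 ≤ q) (hn : n ≤ q) {y : ℤ}
    (h : ((q : ℤ) + 1) * (q + 1) ≤ y) : flatCoeff q n y = 0 := by
  have := Int.le_ediv_of_mul_le (a := q + 1) (b := y) (c := q + 1) (by omega) h
  exact torusCoeff_eq_zero n (.inr (.inl (by omega)))

theorem flatCoeff_add_two {q n : ℕ} (hn : n + 2 ≤ q) (y : ℤ) : flatCoeff q (n + 2) y =
    flatCoeff q (n + 1) (y - 1) - flatCoeff q n y +
      if y = (n + 2) * (q + 1) + 2 then 1 else 0 := by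
  obtain ⟨i, j, h0, hj, rfl⟩ := exists_eq_mul_add q y
  have hflag : i * ((q : ℤ) + 1) + j = (n + 2) * (q + 1) + 2 ↔
      i - 1 = (n : ℤ) + 1 ∧ j - 1 = 1 := by
    constructor
    · intro h
      have h1 : j = 2 := by
        have := congrArg (· % ((q : ℤ) + 1)) h
        simp only [add_comm _ j, add_comm _ (2 : ℤ), Int.add_mul_emod_self_right] at this
        rwa [Int.emod_eq_of_lt h0 (by omega), Int.emod_eq_of_lt (by omega) (by omega)] at this
      have h2 : (i - (n + 2)) * ((q : ℤ) + 1) = 0 := by linarith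
      have := (mul_eq_zero.1 h2).resolve_right (by omega)
      omega
    · rintro ⟨h1, h2⟩
      rw [show i = n + 2 by omega, show j = 2 by omega]
  rw [flatCoeff_mul_add _ _ h0 hj, flatCoeff_mul_add _ _ h0 hj, torusCoeff_add_two,
    if_congr hflag rfl rfl]
  congr 2
  -- In the first column the shift reads the last column of the preceding row, which vanishes by the
  -- degree bound, just as the coefficient of `z ^ (-2)` does.
  by_cases h : j = 0
  · rw [h, show i * ((q : ℤ) + 1) + 0 - 1 = (i - 1) * (q + 1) + q by ring,
      flatCoeff_mul_add _ _ (by omega) le_rfl, torusCoeff_eq_zero _ (by omega),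
      torusCoeff_eq_zero _ (by push_cast; omega)]
  · rw [add_sub_assoc, flatCoeff_mul_add _ _ (by omega) (by omega)]

/-- A machine whose first cells hold the coefficients of `torusPolynomial q` outputs it. -/
theorem output_eq_torusPolynomial {q : ℕ} (hq : 2 ≤ q) {m : ℤ → ℤ}
    (h : ∀ x : ℤ, 0 ≤ x → x < (q + 1) * (q + 1) → m x = flatCoeff q q x) :
    output q m = torusPolynomial q := by
  have hcell (i j : ℕ) (hi : i ∈ Finset.range (q + 1)) (hj : j ∈ Finset.range (q + 1)) :
      m ((i : ℤ) * (q + 1) + j) = torusCoeff q (i - 1) (j - 1) := by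
    rw [Finset.mem_range] at hi hj
    rw [h _ (by positivity), flatCoeff_mul_add _ _ (by omega) (by omega)]
    have : ((i : ℤ) + 1) * (q + 1) ≤ (q + 1) * (q + 1) := by gcongr; omega
    linarith
  ext ⟨a, b⟩
  change _ = torusCoeff q a b
  simp only [output, AddMonoidAlgebra.coeff_sum, AddMonoidAlgebra.coeff_smul,
    Finsupp.coe_finsetSum, Finset.sum_apply, Finsupp.smul_apply, coeff_mono]
  by_cases hab : 0 ≤ a + 1 ∧ a + 1 ≤ q ∧ 0 ≤ b + 1 ∧ b + 1 ≤ q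
  · obtain ⟨i, hi⟩ := Int.eq_ofNat_of_zero_le hab.1
    obtain ⟨j, hj⟩ := Int.eq_ofNat_of_zero_le hab.2.2.1
    have hir : i ∈ Finset.range (q + 1) := by rw [Finset.mem_range]; omega
    have hjr : j ∈ Finset.range (q + 1) := by rw [Finset.mem_range]; omega
    rw [Finset.sum_eq_single_of_mem i hir, Finset.sum_eq_single_of_mem j hjr, hcell i j hir hjr,
      if_pos (by omega), smul_eq_mul, mul_one, ← hi, ← hj, add_sub_cancel_right,
      add_sub_cancel_right]
    · intro j' _ hj'
      rw [if_neg (by omega), smul_zero]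
    · intro i' _ hi'
      refine Finset.sum_eq_zero fun j' _ => ?_
      rw [if_neg (by omega), smul_zero]
  · rw [torusCoeff_eq_zero q (by omega)]
    refine Finset.sum_eq_zero fun i hi => Finset.sum_eq_zero fun j hj => ?_
    rw [Finset.mem_range] at hi hj
    rw [if_neg (by omega), smul_zero]

/-! ### The contents of the memory -/

/-- The length of the part of the memory that is reserved for the coefficients of one of the
polynomials `torusPolynomial n`. -/
def stride (q : ℕ) : ℤ := (q + 1) * (q + 1) + (q + 1)

theorem stride_pos (q : ℕ) : 0 < stride q := by
  unfold stride
  positivity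

theorem mul_add_inj_of_lt {s r r' y y' : ℤ} (hy : 0 ≤ y) (hy' : 0 ≤ y') (h : y < s) (h' : y' < s) :
    r * s + y = r' * s + y' ↔ r = r' ∧ y = y' := by
  constructor
  · intro he
    have hr : r = r' := by
      have := congrArg (· / s) he
      simpa only [add_comm _ y, add_comm _ y', Int.add_mul_ediv_right _ _ (hy.trans_lt h).ne',
        Int.ediv_eq_zero_of_lt hy h, Int.ediv_eq_zero_of_lt hy' h', zero_add] using this
    exact ⟨hr, by rw [hr] at he; linarith⟩
  · rintro ⟨rfl, rfl⟩
    rfl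

/-- The final contents of the memory: the coefficients of `torusPolynomial n` from the address
`(q - n) * stride q` on. -/
noncomputable def cellValue (q : ℕ) (x : ℤ) : ℤ :=
  flatCoeff q (q - x / stride q).toNat (x % stride q)

theorem cellValue_mul_add {q n : ℕ} {y : ℤ} (h0 : 0 ≤ y) (h : y < stride q) :
    cellValue q ((q - n) * stride q + y) = flatCoeff q n y := by
  have hs := (stride_pos q).ne'
  rw [cellValue, add_comm, Int.add_mul_ediv_right _ _ hs, Int.add_mul_emod_self_right,
    Int.ediv_eq_zero_of_lt h0 h, Int.emod_eq_of_lt h0 h,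
    zero_add, sub_sub_cancel, Int.toNat_natCast]

open Classical in
/-- The inhomogeneous terms of the recursion for the memory contents, for the first `j` rows. -/
noncomputable def source (q j : ℕ) (x : ℤ) : ℤ :=
  if ∃ i : ℕ, i < j ∧ x = q * (q + 1) + 2 + i * ((q + 1) * (q + 1)) then 1 else 0

theorem source_zero (q : ℕ) (x : ℤ) : source q 0 x = 0 := by
  simp [source]

theorem source_succ (q j : ℕ) (x : ℤ) : source q (j + 1) x =
    if x = q * (q + 1) + 2 + j * ((q + 1) * (q + 1)) then 1 else source q j x := by
  unfold source
  by_cases h : x = q * (q + 1) + 2 + j * ((q + 1) * (q + 1))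
  · rw [if_pos h, if_pos ⟨j, by omega, h⟩]
  · rw [if_neg h]
    refine if_congr ⟨?_, ?_⟩ rfl rfl
    · rintro ⟨i, hi, hx⟩
      have : i ≠ j := fun hij => h (hij ▸ hx)
      exact ⟨i, by omega, hx⟩
    · rintro ⟨i, hi, hx⟩
      exact ⟨i, by omega, hx⟩

theorem exists_eq_row (q : ℕ) {r : ℕ} (hr : r ≤ q + 1) {x : ℤ} (h0 : 0 ≤ x)
    (h : x < r * stride q) : ∃ (n : ℕ) (y : ℤ), q + 1 ≤ n + r ∧ n ≤ q ∧ 0 ≤ y ∧ y < stride q ∧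
      x = (q - n) * stride q + y := by
  have hs := stride_pos q
  have h1 := Int.ediv_nonneg h0 hs.le
  have h2 := Int.ediv_lt_of_lt_mul hs h
  refine ⟨(q - x / stride q).toNat, x % stride q, by omega, by omega, Int.emod_nonneg _ hs.ne',
    Int.emod_lt_of_pos _ hs, ?_⟩
  rw [Int.toNat_of_nonneg (by omega), sub_sub_cancel, mul_comm, Int.mul_ediv_add_emod]

/-- The monomial `a^(n+1) z` of block `i = q - (n + 2)` sits at offset `(q - i) * (q + 1) + 2`.
Added to `i * stride q`, this gives an arithmetic progression with difference `(q + 1)²`, so the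
program finds the next address by one addition. -/
theorem source_eq {q n : ℕ} (hn : n + 2 ≤ q) {y : ℤ} (h0 : 0 ≤ y) (h : y < stride q) :
    source q (q - 1) ((q - (n + 2 : ℕ)) * stride q + y) =
      if y = (n + 2) * (q + 1) + 2 then 1 else 0 := by
  unfold source
  refine if_congr ?_ rfl rfl
  have key (i : ℕ) (hi : i < q - 1) :
      (q - (n + 2 : ℕ)) * stride q + y = q * (q + 1) + 2 + i * ((q + 1) * (q + 1)) ↔
        (q : ℤ) - (n + 2 : ℕ) = i ∧ y = (q - i) * (q + 1) + 2 := by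
    have hiq : (i : ℤ) ≤ q := by omega
    have hb : ((q : ℤ) - i) * (q + 1) ≤ q * (q + 1) := by gcongr; omega
    rw [show (q : ℤ) * (q + 1) + 2 + i * ((q + 1) * (q + 1)) =
      i * stride q + ((q - i) * (q + 1) + 2) by unfold stride; ring]
    refine mul_add_inj_of_lt h0 ?_ h ?_
    · have := mul_nonneg (sub_nonneg.2 hiq) (show (0 : ℤ) ≤ q + 1 by omega)
      omega
    · unfold stride
      have : (2 : ℤ) ≤ q := by omega
      nlinarith
  constructor
  · rintro ⟨i, hi, hx⟩
    obtain ⟨h1, h2⟩ := (key i hi).1 hx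
    rw [h2, ← h1]
    push_cast
    ring
  · intro hy
    refine ⟨q - (n + 2), by omega, (key _ (by omega)).2 ⟨by omega, ?_⟩⟩
    rw [hy, Nat.cast_sub hn]
    push_cast
    ring

/-- The last source lies in the block of `torusPolynomial 2`, so the two initial blocks stay
untouched. -/
theorem source_of_le {q : ℕ} (hq : 2 ≤ q) {x : ℤ} (h : ((q : ℤ) - 1) * stride q ≤ x) :
    source q (q - 1) x = 0 := by
  refine if_neg ?_
  rintro ⟨i, hi, rfl⟩
  have hi' : (i : ℤ) ≤ q - 2 := by omega
  have hq' : (2 : ℤ) ≤ q := by omega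
  unfold stride at h
  nlinarith [mul_le_mul_of_nonneg_right hi' (show (0 : ℤ) ≤ (q + 1) * (q + 1) by positivity)]

/-- Blocks are stored in descending order of `n`, so the two preceding polynomials lie one and two
strides further on. At the start of a block the shift by one reads the last cell of that same block;
it belongs to the zero padding beyond `(q + 1)²`, as required. -/
theorem cellValue_recursion {q : ℕ} (hq : 2 ≤ q) {x : ℤ} (h0 : 0 ≤ x)
    (h : x < ((q : ℤ) - 1) * stride q) : cellValue q x = source q (q - 1) x +
      cellValue q (x + (stride q - 1)) - cellValue q (x + 2 * stride q) := by
  have hs : (q + 1 : ℤ) * (q + 1) + 1 ≤ stride q := by unfold stride; omega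
  obtain ⟨n, y, hn, hnq, hy, hy', rfl⟩ := exists_eq_row q (r := q - 1) (by omega) h0
    (by rwa [Nat.cast_sub (by omega), Nat.cast_one])
  obtain ⟨n, rfl⟩ := Nat.exists_eq_add_of_le' (show 2 ≤ n by omega)
  rw [cellValue_mul_add hy hy', source_eq hnq hy hy', flatCoeff_add_two hnq,
    show ((q : ℤ) - (n + 2 : ℕ)) * stride q + y + 2 * stride q = (q - n) * stride q + y by
      push_cast; ring,
    cellValue_mul_add hy hy']
  have hprev : cellValue q ((q - (n + 2 : ℕ)) * stride q + y + (stride q - 1)) =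
      flatCoeff q (n + 1) (y - 1) := by
    by_cases hy0 : y = 0
    · rw [hy0, add_zero, cellValue_mul_add (by have := stride_pos q; omega) (by omega),
        flatCoeff_of_le hq hnq (by omega), flatCoeff_of_neg (by omega)]
    · rw [show ((q : ℤ) - (n + 2 : ℕ)) * stride q + y + (stride q - 1) =
          (q - (n + 1 : ℕ)) * stride q + (y - 1) by push_cast; ring,
        cellValue_mul_add (by omega) (by omega)]
  rw [hprev]
  ring

theorem flat_index_iff {q : ℕ} {y r c : ℤ} (h0 : 0 ≤ c) (h : c ≤ q) :
    (y / (q + 1) - 1 = r ∧ y % (q + 1) - 1 = c - 1) ↔ y = (r + 1) * (q + 1) + c := by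
  obtain ⟨i, j, hj0, hj, rfl⟩ := exists_eq_mul_add q y
  rw [mul_add_inj_of_lt hj0 h0 (by omega) (by omega), add_comm, Int.add_mul_ediv_right _ _ (by omega),
    Int.add_mul_emod_self_right, Int.ediv_eq_zero_of_lt hj0 (by omega),
    Int.emod_eq_of_lt hj0 (by omega)]
  omega

theorem flatCoeff_zero {q : ℕ} (hq : 2 ≤ q) (y : ℤ) : flatCoeff q 0 y =
    if y = 2 * (q + 1) then 1 else if y = q + 2 then -1 else if y = 0 then 1 else 0 := by
  have h1 := flat_index_iff (q := q) (y := y) (r := 1) (c := 0) (by omega) (by omega)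
  have h2 := flat_index_iff (q := q) (y := y) (r := -1) (c := 0) (by omega) (by omega)
  have h3 := flat_index_iff (q := q) (y := y) (r := 0) (c := 1) (by omega) (by omega)
  rw [flatCoeff, torusCoeff_zero]
  split_ifs <;> omega

theorem flatCoeff_one {q : ℕ} (hq : 2 ≤ q) (y : ℤ) : flatCoeff q 1 y = if y = 1 then 1 else 0 := by
  have h1 := flat_index_iff (q := q) (y := y) (r := -1) (c := 1) (by omega) (by omega)
  rw [flatCoeff, torusCoeff_one]
  split_ifs <;> omega

/-- The nonzero cells are the coefficients of `a`, `1` and `a⁻¹ ` over `z` powers in `delta`, and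
the single one of `torusPolynomial 1`; the program writes exactly these four. -/
theorem cellValue_initial {q : ℕ} (hq : 2 ≤ q) {x : ℤ} (h : ((q : ℤ) - 1) * stride q ≤ x)
    (h' : x < (q + 1) * stride q) : cellValue q x =
      if x = q * stride q + 2 * (q + 1) then 1 else if x = q * stride q + (q + 2) then -1
      else if x = q * stride q then 1 else if x = (q - 1) * stride q + 1 then 1 else 0 := by
  have hs := stride_pos q
  have hs' : (q + 1 : ℤ) * (q + 1) + (q + 1) = stride q := rfl
  have hs'' : 3 * (q + 1 : ℤ) ≤ (q + 1) * (q + 1) := by gcongr; omega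
  rw [sub_mul, one_mul] at h ⊢
  rw [add_mul, one_mul] at h'
  by_cases hx : x < q * stride q
  · obtain ⟨y, rfl⟩ : ∃ y, x = (q - (1 : ℕ)) * stride q + y :=
      ⟨x - (q - (1 : ℕ)) * stride q, by ring⟩
    have he : ((q : ℤ) - (1 : ℕ)) * stride q = q * stride q - stride q := by push_cast; ring
    rw [cellValue_mul_add (by omega) (by omega), flatCoeff_one hq, he]
    split_ifs <;> omega
  · obtain ⟨y, rfl⟩ : ∃ y, x = (q - (0 : ℕ)) * stride q + y :=
      ⟨x - (q - (0 : ℕ)) * stride q, by ring⟩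
    have he : ((q : ℤ) - (0 : ℕ)) * stride q = q * stride q := by push_cast; ring
    rw [cellValue_mul_add (by omega) (by omega), flatCoeff_zero hq, he]
    split_ifs <;> omega

/-! ### The program -/

/-- The program `p`, started with memory `m`, halts after at most `B` steps with a memory that
satisfies `Q`. -/
def Program.Reaches (p : Program) (B : ℕ) (Q : (ℤ → ℤ) → Prop) (m : ℤ → ℤ) : Prop :=
  ∃ (m' : ℤ → ℤ) (t : ℕ), Runs p m m' t ∧ t ≤ B ∧ Q m'

namespace Program.Reaches

variable {p p' : Program} {B B' : ℕ} {Q Q' : (ℤ → ℤ) → Prop} {m m' : ℤ → ℤ}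

theorem atom (h : Runs p m m' 1) (hQ : Q m') : p.Reaches (B + 1) Q m :=
  ⟨m', 1, h, by omega, hQ⟩

theorem seq (h : p.Reaches B Q m) (h' : ∀ m', Q m' → p'.Reaches B' Q' m') :
    (p.seq p').Reaches (B + B') Q' m := by
  obtain ⟨m₁, t₁, hr₁, ht₁, hQ₁⟩ := h
  obtain ⟨m₂, t₂, hr₂, ht₂, hQ₂⟩ := h' m₁ hQ₁
  exact ⟨m₂, t₁ + t₂, hr₁.seq hr₂, by omega, hQ₂⟩

theorem seq_atom (h : Runs p m m' 1) (h' : p'.Reaches B Q m') :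
    (p.seq p').Reaches (B + 1) Q m := by
  obtain ⟨m₂, t₂, hr₂, ht₂, hQ₂⟩ := h'
  exact ⟨m₂, 1 + t₂, h.seq hr₂, by omega, hQ₂⟩

theorem imp (h : p.Reaches B Q m) (hQ : ∀ m', Q m' → Q' m') : p.Reaches B Q' m := by
  obtain ⟨m₁, t₁, hr₁, ht₁, hQ₁⟩ := h
  exact ⟨m₁, t₁, hr₁, ht₁, hQ m₁ hQ₁⟩

/-- A loop whose counter `x` decreases by one in each round. -/
theorem whilePos {x : ℤ} {I : ℕ → (ℤ → ℤ) → Prop} (hx : ∀ k m, I k m → m x = k)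
    (hp : ∀ k m, I (k + 1) m → p.Reaches B (I k) m) (k : ℕ) {m : ℤ → ℤ} (hm : I k m) :
    (Program.whilePos x p).Reaches (k * (B + 1) + 1) (I 0) m := by
  induction k generalizing m with
  | zero => exact ⟨m, 1, .while_false (hx 0 m hm).le, by omega, hm⟩
  | succ k ih =>
    obtain ⟨m₁, t₁, hr₁, ht₁, hI₁⟩ := hp k m hm
    obtain ⟨m₂, t₂, hr₂, ht₂, hI₂⟩ := ih hI₁
    refine ⟨m₂, t₁ + t₂ + 1, .while_true ?_ hr₁ hr₂, ?_, hI₂⟩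
    · rw [hx _ m hm]
      positivity
    · rw [add_mul]
      omega

end Program.Reaches

theorem Runs.add_of_eq {x y y' c : ℤ} {m : ℤ → ℤ} (h : m y + m y' = c) :
    Runs (.add x y y') m (Function.update m x c) 1 := h ▸ .add x y y' m

theorem Runs.sub_of_eq {x y y' c : ℤ} {m : ℤ → ℤ} (h : m y - m y' = c) :
    Runs (.sub x y y') m (Function.update m x c) 1 := h ▸ .sub x y y' m

theorem Runs.store_of_eq {x x' y c : ℤ} {m : ℤ → ℤ} (h : m x = x') (h' : m y = c) :
    Runs (.store x y) m (Function.update m x' c) 1 := h ▸ h' ▸ .store x y m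

/-- Moves the input to the register `-1`. -/
def setup : Program :=
  .seq (.const (-2) 1) <| .seq (.add (-1) 0 (-13)) <| .seq (.const 0 0) <|
    .seq (.add (-3) (-1) (-2)) (.add (-5) (-1) (-13))

/-- Registers are negative cells, which leaves the non-negative ones for the table. Cell `-13` is
never written and serves as zero, `-2` holds `1`, `-3` holds `q + 1`, and `-5` counts the rounds of
each loop. Here `q` rounds accumulate `q * (q + 1)` in `-4`. -/
def multiplyBody : Program :=
  .seq (.add (-4) (-4) (-3)) (.sub (-5) (-5) (-2))

def prepareSource : Program :=
  .seq (.add (-6) (-4) (-3)) <| .seq (.add (-6) (-6) (-3)) <| .seq (.sub (-8) (-6) (-3)) <|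
    .seq (.sub (-11) (-6) (-2)) <| .seq (.add (-12) (-6) (-6)) <| .seq (.sub (-5) (-1) (-2)) <|
    .seq (.add (-7) (-4) (-2)) (.add (-7) (-7) (-2))

def sourceBody : Program :=
  .seq (.store (-7) (-2)) <| .seq (.add (-7) (-7) (-8)) (.sub (-5) (-5) (-2))

/-- Writes the coefficients of the first two polynomials. -/
def writeInitial : Program :=
  .seq (.sub (-7) (-7) (-3)) <| .seq (.sub (-7) (-7) (-2)) <| .seq (.store (-7) (-2)) <|
    .seq (.sub (-7) (-7) (-2)) <| .seq (.add (-5) (-7) (-13)) <| .seq (.add (-7) (-7) (-6)) <|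
    .seq (.store (-7) (-2)) <| .seq (.add (-7) (-7) (-3)) <| .seq (.add (-7) (-7) (-2)) <|
    .seq (.sub (-9) (-13) (-2)) <| .seq (.store (-7) (-9)) <| .seq (.add (-7) (-7) (-3)) <|
    .seq (.sub (-7) (-7) (-2)) (.store (-7) (-2))

/-- The counter `-5` is decremented first and is then the address being computed. Addresses descend,
so both cells read are final, and the source term is overwritten in place. -/
def recursionBody : Program :=
  .seq (.sub (-5) (-5) (-2)) <| .seq (.load (-9) (-5)) <| .seq (.add (-10) (-5) (-11)) <|
    .seq (.load (-10) (-10)) <| .seq (.add (-9) (-9) (-10)) <| .seq (.add (-10) (-5) (-12)) <|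
    .seq (.load (-10) (-10)) <| .seq (.sub (-9) (-9) (-10)) (.store (-5) (-9))

/-- A program computing the coefficients of the Kauffman polynomials of torus links. -/
def torusProgram : Program :=
  .seq setup <| .seq (.whilePos (-5) multiplyBody) <| .seq prepareSource <|
    .seq (.whilePos (-5) sourceBody) <| .seq writeInitial (.whilePos (-5) recursionBody)

/-- The memory after `q - k` rounds of the first loop. -/
def MultiplyInv (q k : ℕ) (m : ℤ → ℤ) : Prop :=
  m (-1) = q ∧ m (-2) = 1 ∧ m (-3) = q + 1 ∧ m (-4) = (q - k) * (q + 1) ∧ m (-5) = k ∧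
    m (-13) = 0 ∧ ∀ x, 0 ≤ x → m x = 0

/-- The memory when `k` rounds of the second loop remain. -/
def SourceInv (q k : ℕ) (m : ℤ → ℤ) : Prop :=
  m (-2) = 1 ∧ m (-3) = q + 1 ∧ m (-5) = k ∧ m (-6) = stride q ∧ m (-8) = (q + 1) * (q + 1) ∧
    m (-11) = stride q - 1 ∧ m (-12) = 2 * stride q ∧ m (-13) = 0 ∧
    ∃ j : ℕ, j + k + 1 = q ∧ m (-7) = q * (q + 1) + 2 + j * ((q + 1) * (q + 1)) ∧
      ∀ x, 0 ≤ x → m x = source q j x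

/-- The memory when `k` rounds of the third loop remain. -/
def RecursionInv (q k : ℕ) (m : ℤ → ℤ) : Prop :=
  m (-2) = 1 ∧ m (-5) = k ∧ m (-11) = stride q - 1 ∧ m (-12) = 2 * stride q ∧
    k ≤ ((q : ℤ) - 1) * stride q ∧
    ∀ x, 0 ≤ x → x < (q + 1) * stride q →
      m x = if x < k then source q (q - 1) x else cellValue q x

/-! ### Correctness and running time of the program -/

theorem setup_reaches (q : ℕ) : setup.Reaches 5 (MultiplyInv q q) (input q) := by
  refine .seq_atom (.const ..) <| .seq_atom (.add ..) <| .seq_atom (.const ..) <|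
    .seq_atom (.add ..) <| .atom (.add ..) ?_
  refine ⟨?_, ?_, ?_, ?_, ?_, ?_, fun x hx => ?_⟩
  iterate 6 simp [input]
  have h1 : x ≠ -1 := by omega
  have h2 : x ≠ -2 := by omega
  have h3 : x ≠ -3 := by omega
  have h5 : x ≠ -5 := by omega
  simp +contextual [input, Function.update_apply, h1, h2, h3, h5]

theorem multiplyBody_reaches {q k : ℕ} {m : ℤ → ℤ} (h : MultiplyInv q (k + 1) m) :
    multiplyBody.Reaches 2 (MultiplyInv q k) m := by
  obtain ⟨h1, h2, h3, h4, h5, h13, hx⟩ := h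
  refine .seq_atom (.add ..) <| .atom (.sub ..) ?_
  refine ⟨?_, ?_, ?_, ?_, ?_, ?_, fun x hx0 => ?_⟩
  · simp [h1]
  · simp [h2]
  · simp [h3]
  · simp [h3, h4]
    ring
  · simp [h2, h5]
  · simp [h13]
  · have h4 : x ≠ -4 := by omega
    have h5 : x ≠ -5 := by omega
    simp [h4, h5, hx x hx0]

theorem prepareSource_reaches {q : ℕ} (hq : 2 ≤ q) {m : ℤ → ℤ} (h : MultiplyInv q 0 m) :
    prepareSource.Reaches 8 (SourceInv q (q - 1)) m := by
  obtain ⟨h1, h2, h3, h4, h5, h13, hx⟩ := h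
  refine .seq_atom (.add ..) <| .seq_atom (.add ..) <| .seq_atom (.sub ..) <|
    .seq_atom (.sub ..) <| .seq_atom (.add ..) <| .seq_atom (.sub ..) <| .seq_atom (.add ..) <|
    .atom (.add ..) ?_
  refine ⟨?_, ?_, ?_, ?_, ?_, ?_, ?_, ?_, 0, by omega, ?_, fun x hx0 => ?_⟩
  · simp [h2]
  · simp [h3]
  · simp [h1, h2, Nat.cast_sub (show 1 ≤ q by omega)]
  · simp [h3, h4, stride]
    ring
  · simp [h3, h4]
    ring
  · simp [h2, h3, h4, stride]
    ring
  · simp [h3, h4, stride]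
    ring
  · simp [h13]
  · simp [h2, h4]
    ring
  · have h5 : x ≠ -5 := by omega
    have h6 : x ≠ -6 := by omega
    have h7 : x ≠ -7 := by omega
    have h8 : x ≠ -8 := by omega
    have h11 : x ≠ -11 := by omega
    have h12 : x ≠ -12 := by omega
    simp [h5, h6, h7, h8, h11, h12, hx x hx0, source_zero]

theorem sourceBody_reaches {q k : ℕ} {m : ℤ → ℤ} (h : SourceInv q (k + 1) m) :
    sourceBody.Reaches 3 (SourceInv q k) m := by
  obtain ⟨h2, h3, h5, h6, h8, h11, h12, h13, j, hj, h7, hx⟩ := h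
  refine .seq_atom (.store ..) <| .seq_atom (.add ..) <| .atom (.sub ..) ?_
  rw [h7]
  have hpos : 0 ≤ (q : ℤ) * (q + 1) + 2 + j * ((q + 1) * (q + 1)) := by positivity
  generalize hA : (q : ℤ) * (q + 1) + 2 + j * ((q + 1) * (q + 1)) = A at *
  have hne (r : ℤ) (hr : r < 0) : r ≠ A := by omega
  refine ⟨?_, ?_, ?_, ?_, ?_, ?_, ?_, ?_, j + 1, by omega, ?_, fun x hx0 => ?_⟩
  · simp [hne, h2]
  · simp [hne, h3]
  · simp [hne, h2, h5]
  · simp [hne, h6]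
  · simp [hne, h8]
  · simp [hne, h11]
  · simp [hne, h12]
  · simp [hne, h13]
  · simp [hne, h7, h8]
    rw [← hA]
    ring
  · have h5 : x ≠ -5 := by omega
    have h7 : x ≠ -7 := by omega
    simp [Function.update_apply, hne, h2, h5, h7, hx x hx0, source_succ, hA]

theorem writeInitial_reaches {q : ℕ} (hq : 2 ≤ q) {m : ℤ → ℤ} (h : SourceInv q 0 m) :
    writeInitial.Reaches 14 (RecursionInv q ((q - 1) * ((q + 1) * (q + 1) + (q + 1)))) m := by
  obtain ⟨h2, h3, h5, h6, h8, h11, h12, h13, j, hj, h7, hx⟩ := h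
  obtain rfl : j = q - 1 := by omega
  have hS : 0 < stride q := stride_pos q
  have hk : (((q - 1) * ((q + 1) * (q + 1) + (q + 1)) : ℕ) : ℤ) = (q - 1) * stride q := by
    rw [stride]
    push_cast [Nat.cast_sub (show 1 ≤ q by omega)]
    ring
  have hA : m (-7) = (q - 1) * stride q + (q + 1) + 2 := by
    rw [h7, stride]
    push_cast [Nat.cast_sub (show 1 ≤ q by omega)]
    ring
  have hA0 : 0 ≤ ((q : ℤ) - 1) * stride q := mul_nonneg (by omega) hS.le
  have hb : ((q : ℤ) - 1) * stride q + stride q = q * stride q := by ring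
  have hsource (x : ℤ) := source_of_le hq (x := x)
  have hV := @cellValue_initial q hq
  have hW : (q : ℤ) * (q + 1) ≥ 2 * (q + 1) := by gcongr; omega
  have hSW : stride q = q * (q + 1) + 2 * (q + 1) := by rw [stride]; ring
  generalize hB : ((q : ℤ) - 1) * stride q = b at *
  generalize hC : (q : ℤ) * stride q = a₂ at *
  -- `a₁`, …, `a₄` are the addresses of the four nonzero initial coefficients; with the products
  -- named `b` and `a₂`, all comparisons of addresses are linear.
  obtain ⟨a₁, ha₁⟩ : ∃ a, a = b + 1 := ⟨_, rfl⟩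
  obtain ⟨a₃, ha₃⟩ : ∃ a, a = a₂ + (q + 2) := ⟨_, rfl⟩
  obtain ⟨a₄, ha₄⟩ : ∃ a, a = a₂ + 2 * (q + 1) := ⟨_, rfl⟩
  have n₁ (r : ℤ) (hr : r < 0) : r ≠ a₁ := by omega
  have n₂ (r : ℤ) (hr : r < 0) : r ≠ a₂ := by omega
  have n₃ (r : ℤ) (hr : r < 0) : r ≠ a₃ := by omega
  have n₄ (r : ℤ) (hr : r < 0) : r ≠ a₄ := by omega
  refine .seq_atom (.sub_of_eq (c := b + 2) ?_) <| .seq_atom (.sub_of_eq (c := a₁) ?_) <|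
    .seq_atom (.store_of_eq (x' := a₁) (c := 1) ?_ ?_) <|
    .seq_atom (.sub_of_eq (c := b) ?_) <| .seq_atom (.add_of_eq (c := b) ?_) <|
    .seq_atom (.add_of_eq (c := a₂) ?_) <| .seq_atom (.store_of_eq (x' := a₂) (c := 1) ?_ ?_) <|
    .seq_atom (.add_of_eq (c := a₂ + (q + 1)) ?_) <| .seq_atom (.add_of_eq (c := a₃) ?_) <|
    .seq_atom (.sub_of_eq (c := -1) ?_) <|
    .seq_atom (.store_of_eq (x' := a₃) (c := -1) ?_ ?_) <|
    .seq_atom (.add_of_eq (c := a₃ + (q + 1)) ?_) <| .seq_atom (.sub_of_eq (c := a₄) ?_) <|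
    .atom (.store_of_eq (x' := a₄) (c := 1) ?_ ?_)
    ⟨?_, ?_, ?_, ?_, ?_, fun x hx0 hx1 => ?_⟩
  iterate 18 simp [n₁, n₂, n₃, h2, h3, h6, h13, hA] <;> omega
  · simp [n₁, n₂, n₃, n₄, h2]
  · simp [n₂, n₃, n₄, hk]
  · simp [n₁, n₂, n₃, n₄, h11]
  · simp [n₁, n₂, n₃, n₄, h12]
  · rw [hk, hB]
  · have nx (r : ℤ) (hr : r < 0) : x ≠ r := by omega
    simp only [Function.update_apply, nx _ (show (-7 : ℤ) < 0 by omega),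
      nx _ (show (-5 : ℤ) < 0 by omega), nx _ (show (-9 : ℤ) < 0 by omega), if_false, hx x hx0]
    rw [hk]
    by_cases hxb : x < b
    · rw [if_pos hxb]
      split_ifs <;> omega
    · rw [if_neg hxb, hV (not_lt.1 hxb) hx1, hsource x (not_lt.1 hxb)]
      split_ifs <;> omega

theorem recursionBody_reaches {q k : ℕ} (hq : 2 ≤ q) {m : ℤ → ℤ} (h : RecursionInv q (k + 1) m) :
    recursionBody.Reaches 9 (RecursionInv q k) m := by
  obtain ⟨h2, h5, h11, h12, hk, hx⟩ := h
  have hS : 0 < stride q := stride_pos q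
  push_cast at hk h5 hx
  refine .seq_atom (.sub ..) <| .seq_atom (.load ..) <| .seq_atom (.add ..) <|
    .seq_atom (.load ..) <| .seq_atom (.add ..) <| .seq_atom (.add ..) <| .seq_atom (.load ..) <|
    .seq_atom (.sub ..) <| .atom (.store ..) ?_
  have hb : ((q : ℤ) - 1) * stride q + 2 * stride q = (q + 1) * stride q := by ring
  have hv0 := hx k (by omega) (by omega)
  have hv1 := hx (k + (stride q - 1)) (by omega) (by omega)
  have hv2 := hx (k + 2 * stride q) (by omega) (by omega)
  rw [if_pos (by omega)] at hv0
  rw [if_neg (by omega)] at hv2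
  have hrec := cellValue_recursion hq (x := k) (by omega) (by omega)
  -- This places the address `k + (stride q - 1)` above `k`, in the part that is already final.
  have hS1 : 1 < stride q := by unfold stride; nlinarith
  rw [if_neg (by omega)] at hv1
  have n0 (r : ℤ) (hr : r < 0) : r ≠ k := by omega
  have n0' (r : ℤ) (hr : r < 0) : (k : ℤ) ≠ r := by omega
  have n1 (r : ℤ) (hr : r < 0) : (k : ℤ) + (stride q - 1) ≠ r := by omega
  have n2 (r : ℤ) (hr : r < 0) : (k : ℤ) + 2 * stride q ≠ r := by omega
  refine ⟨?_, ?_, ?_, ?_, by omega, fun x hx0 hx1 => ?_⟩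
  · simp [Function.update_apply, n0, h2, h5]
  · simp [Function.update_apply, n0, h2, h5]
  · simp [Function.update_apply, n0, h2, h5, h11]
  · simp [Function.update_apply, n0, h2, h5, h12]
  · have nx (r : ℤ) (hr : r < 0) : x ≠ r := by omega
    have hxx := hx x hx0 hx1
    simp [Function.update_apply, nx, n0', n1, n2, h2, h5, h11, h12, hv0, hv1, hv2]
    rw [hxx]
    split_ifs <;> first | omega | (subst_vars; omega)

theorem torusProgram_reaches {q : ℕ} (hq : 2 ≤ q) :
    torusProgram.Reaches (5 + ((q * (2 + 1) + 1) + (8 + (((q - 1) * (3 + 1) + 1) +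
      (14 + ((q - 1) * ((q + 1) * (q + 1) + (q + 1)) * (9 + 1) + 1))))))
      (fun m => output q m = torusPolynomial q) (input q) := by
  refine .seq (setup_reaches q) fun m h => ?_
  refine .seq (.whilePos (fun _ _ h => h.2.2.2.2.1) (fun _ _ => multiplyBody_reaches) q h)
    fun m h => ?_
  refine .seq (prepareSource_reaches hq h) fun m h => ?_
  refine .seq (.whilePos (fun _ _ h => h.2.2.1) (fun _ _ => sourceBody_reaches) _ h) fun m h => ?_
  refine .seq (writeInitial_reaches hq h) fun m h => ?_
  refine (Program.Reaches.whilePos (fun _ _ h => h.2.1) (fun _ _ => recursionBody_reaches hq) _ h).imp ?_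
  intro m h
  refine output_eq_torusPolynomial hq fun x h0 h1 => ?_
  have hx : x < stride q := by unfold stride; omega
  have hx' : stride q ≤ (q + 1) * stride q :=
    le_mul_of_one_le_left (stride_pos q).le (by omega)
  rw [h.2.2.2.2.2 x h0 (by omega), if_neg (by push_cast; omega)]
  simpa using cellValue_mul_add (n := q) h0 hx

end KauffmanTorus

theorem mainTheorem4 :
    -- the recursive formula for `K(2,q)`
    (∀ q : ℕ, 2 ≤ q →
      K (torusLink q) =
        (P q - ∑ i ∈ Finset.range (q - 1), P i * g (q - 2 - i)) • K unknot) ∧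
    -- the same for every Laurent polynomial valued function obeying the rules for `K`
    (∀ F : LinkDiagram → Laurent, IsKauffmanPolynomial F → ∀ q : ℕ, 2 ≤ q →
      F (torusLink q) = P q - ∑ i ∈ Finset.range (q - 1), P i * g (q - 2 - i)) ∧
    -- the matching polynomial is a signed determinant of the balanced overlaid Tait graph
    (∀ q : ℕ, 1 ≤ q →
      ∃ (ε : Crossing (torusLink q).word → TaitFace (torusLink q).word 2 2 → ℤˣ)
        (e : Crossing (torusLink q).word ≃ TaitFace (torusLink q).word 2 2),
        (Matrix.of fun v v' : Crossing (torusLink q).word =>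
            (ε v (e v') : ℤ) • adjacencyMatrix (torusLink q).word 2 2 v (e v')).det =
          matchingPolynomial (torusLink q).word 2 2) ∧
    -- the coefficients of `K(2,q)` are computed in time polynomial in `q`
    (∃ (p : Program) (bound : Polynomial ℕ), ∀ q : ℕ, 2 ≤ q →
      ∃ (m : ℤ → ℤ) (t : ℕ), Runs p (input q) m t ∧ t ≤ bound.eval q ∧
        K (torusLink q) = output q m • K unknot ∧
        output q m = P q - ∑ i ∈ Finset.range (q - 1), P i * g (q - 2 - i)) := by
  refine ⟨fun q hq => ?_, fun F hF q hq => ?_, fun q hq => ?_, torusProgram,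
    -- The cubic term bounds the third loop, ten steps for each of `(q - 1) * stride q` cells; the
    -- linear part generously covers everything else.
    15 * Polynomial.X + 30 + 10 * (Polynomial.X * ((Polynomial.X + 1) * (Polynomial.X + 1) +
      (Polynomial.X + 1))), fun q hq => ?_⟩
  · rw [K_torusLink, torusPolynomial_eq hq]
  · exact hF.eq_of_K_eq_smul (by rw [K_torusLink, torusPolynomial_eq hq])
  · obtain ⟨n, rfl⟩ := Nat.exists_eq_add_of_le' hq
    exact exists_det_eq_matchingPolynomial n
  · obtain ⟨m, t, hr, ht, hm⟩ := torusProgram_reaches hq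
    refine ⟨m, t, hr, ht.trans ?_, ?_, ?_⟩
    · have h : (q - 1) * ((q + 1) * (q + 1) + (q + 1)) ≤ q * ((q + 1) * (q + 1) + (q + 1)) :=
        Nat.mul_le_mul_right _ (Nat.sub_le q 1)
      simp only [Polynomial.eval_add, Polynomial.eval_mul, Polynomial.eval_X, Polynomial.eval_ofNat,
        Polynomial.eval_one]
      omega
    · rw [hm, K_torusLink]
    · rw [hm, torusPolynomial_eq hq]
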